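/- Let $\Sigma$ be a simplicial rational fan in $N\otimes\mathbb Q$ with rays $\rho_0,\dots,\rho_n$ and primitive generators $u_0,\dots,u_n$, whose toric variety $X$ is projective, let $k$ be a field, and let $S=k[x_0,\dots,x_n]$ be the Cox ring of the associated toric stack, graded by $\operatorname{Cl}(X)=\mathbb Z^{n+1}/\{(\langle m,u_i\rangle)_i : m\in N^\vee\}$, where $\deg x_i$ is the class of the $i$-th standard basis vector. Let $I\subseteq\{0,\dots,n\}$ be a primitive collection, that is, $I$ is not contained in $\sigma(1)$ for any $\sigma\in\Sigma$, but every proper subset of $I$ is. Let $\gamma\in\Sigma$ be the cone with $\sum_{i\in I}u_i$ in its relative interior, write $\sum_{i\in I}u_i=\sum_{i\in\gamma(1)}c_iu_i$ with $c_i\in\mathbb Q_{>0}$, set $c_i=0$ for $i\notin\gamma(1)$, and let $b'_i=1-c_i$ for $i\in I$ and $b'_i=-c_i$ for $i\notin I$. Let $(b_0,\dots,b_n)=\lambda\,(b'_0,\dots,b'_n)$, where $\lambda$ is the least positive integer for which this vector is integral. Let $\deg_I\colon\operatorname{Cl}(X)\to\mathbb Z$ be the homomorphism with $\deg_I(x_i)=b_i$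 (it is well defined). For $0\le j\le\#I$ let $$w_I^j=\max\Big\{\sum_{i\in I'}\deg_I(x_i) : I'\subseteq I,\ \#I'=j\Big\},$$ and put $w_I^{-1}=-1$ and $w_I^j=w_I^{\#I}+1$ for $j>\#I$. Let $M$ be a $\operatorname{Cl}(X)$-graded $S$-module (not necessarily finitely generated). Let $M_I$ be $M$, considered as a module over $S_I=k[x_i : i\in I]$, with the $\mathbb Z$-grading given by $\deg_I$, and let $B_I=\langle x_i : i\in I\rangle\subseteq S_I$. Assume that $M$ is $\deg_I$ $0$-regular, that is, $(H^i_{B_I}M_I)_d=0$ for all $i\ge 0$ and all $d\ge -w_I^{i-1}$. Let $F_0\leftarrow F_1\leftarrow\cdots$ be a minimal graded free resolution of $M$. Then for every $j\geq 0$ each generator $\epsilon$ of $F_j$ satisfies $$\deg_I(\epsilon)<w_I^{j+1}.$$ If moreover $(H^0_{B_I}M_I)_0=0$, then also $\deg_I(\epsilon)<w_I^{\#I}$ for every $j$. -/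

import Mathlib

open scoped TensorProduct

noncomputable section

/-! ### Simplicial fans -/

/-- A rational simplicial fan `Σ` in `N ⊗ ℚ` with `n + 1` rays, for a lattice `N`. The ray `ρ_i` is
given by its primitive generator `ray i ∈ N`, and a cone `σ ∈ Σ` is given by the set `σ(1)` of (the
indices of) its rays; the cone itself is the cone generated by these rays. -/
structure SimplicialFan (N : Type*) [AddCommGroup N] (n : ℕ) where
  /-- the primitive generators `u_0, …, u_n` of the rays -/
  ray : Fin (n + 1) → N
  /-- `cones σ` says that the rays in `σ` are the rays of a cone of the fan -/
  cones : Set (Finset (Fin (n + 1)))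
  ray_primitive : ∀ (i : Fin (n + 1)) (m : ℤ) (v : N), ray i = m • v → IsUnit m
  singleton_mem : ∀ i, {i} ∈ cones
  mem_of_subset : ∀ σ ∈ cones, ∀ τ, τ ⊆ σ → τ ∈ cones
  /-- every cone is simplicial (hence strongly convex) -/
  linearIndepOn : ∀ σ ∈ cones, LinearIndepOn ℚ (fun i => (1 : ℚ) ⊗ₜ[ℤ] ray i) (σ : Set (Fin (n + 1)))
  /-- two cones intersect in their common face -/
  inter : ∀ σ ∈ cones, ∀ τ ∈ cones,
    PointedCone.hull ℚ ((fun i => (1 : ℚ) ⊗ₜ[ℤ] ray i) '' (σ : Set (Fin (n + 1)))) ⊓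
      PointedCone.hull ℚ ((fun i => (1 : ℚ) ⊗ₜ[ℤ] ray i) '' (τ : Set (Fin (n + 1)))) =
    PointedCone.hull ℚ ((fun i => (1 : ℚ) ⊗ₜ[ℤ] ray i) '' ((σ ∩ τ : Finset (Fin (n + 1))) : Set (Fin (n + 1))))

namespace SimplicialFan

variable {N : Type*} [AddCommGroup N] {n : ℕ} (Δ : SimplicialFan N n)

/-- The vector `u_i` in `N ⊗ ℚ`. -/
def rayQ (i : Fin (n + 1)) : ℚ ⊗[ℤ] N := (1 : ℚ) ⊗ₜ[ℤ] Δ.ray i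

/-- The cone in `N ⊗ ℚ` generated by the rays with index in `σ`. -/
def cone (σ : Finset (Fin (n + 1))) : PointedCone ℚ (ℚ ⊗[ℤ] N) :=
  PointedCone.hull ℚ (Δ.rayQ '' (σ : Set (Fin (n + 1))))

/-- The fan is complete: its cones cover `N ⊗ ℚ`. -/
def IsComplete : Prop := ∀ v : ℚ ⊗[ℤ] N, ∃ σ ∈ Δ.cones, v ∈ Δ.cone σ

/-- The toric variety of the fan is projective: the fan is complete, and there is an ample torus
invariant divisor `∑ a_i D_i`, that is, for every maximal cone `σ` there is `m_σ` in the dual lattice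
with `⟨m_σ, u_i⟩ = -a_i` for the rays of `σ` and `⟨m_σ, u_i⟩ > -a_i` for all other rays (the support
function of the divisor is strictly convex). -/
def IsProjective : Prop :=
  Δ.IsComplete ∧ ∃ a : Fin (n + 1) → ℤ, ∀ σ, Maximal (· ∈ Δ.cones) σ →
    ∃ m : N →ₗ[ℤ] ℤ, (∀ i ∈ σ, m (Δ.ray i) = -a i) ∧ ∀ i ∉ σ, -a i < m (Δ.ray i)

/-- A set of rays is a primitive collection if it is not contained in any `σ(1)`, but each of its
proper subsets is contained in some `σ(1)`. -/
def IsPrimitiveCollection (I : Finset (Fin (n + 1))) : Prop :=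
  (∀ σ ∈ Δ.cones, ¬ I ⊆ σ) ∧ ∀ J, J ⊂ I → ∃ σ ∈ Δ.cones, J ⊆ σ

/-! ### The class group and the Cox ring -/

/-- The divisor of a character: `m ↦ (⟨m, u_i⟩)_i`. -/
def charDivisor : (N →ₗ[ℤ] ℤ) →+ (Fin (n + 1) → ℤ) where
  toFun m i := m (Δ.ray i)
  map_zero' := by ext; simp
  map_add' := by intros; ext; simp

/-- The class group `Cl(X)`: torus invariant divisors modulo divisors of characters. -/
abbrev ClassGroup : Type := (Fin (n + 1) → ℤ) ⧸ Δ.charDivisor.range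

instance : DecidableEq Δ.ClassGroup := Classical.decEq _

/-- The degree `[D_i] ∈ Cl(X)` of the variable `x_i` of the Cox ring. -/
def varDegree (i : Fin (n + 1)) : Δ.ClassGroup :=
  QuotientAddGroup.mk (Pi.single i 1)

/-- The `Cl(X)`-grading of the Cox ring `S = k[x_0, …, x_n]`. -/
abbrev coxGrading (k : Type*) [Field k] :
    Δ.ClassGroup → Submodule k (MvPolynomial (Fin (n + 1)) k) :=
  MvPolynomial.weightedHomogeneousSubmodule k Δ.varDegree

/-! ### The functional of a set of rays -/

variable {Δ}

/-- In a complete fan every vector is a positive combination of the rays of a cone of the fan. -/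
theorem IsComplete.exists_coeff (hΔ : Δ.IsComplete) (v : ℚ ⊗[ℤ] N) :
    ∃ c : Fin (n + 1) → ℚ, (∀ i, 0 ≤ c i) ∧ Finset.univ.filter (fun i => c i ≠ 0) ∈ Δ.cones ∧
      v = ∑ i, c i • Δ.rayQ i := by
  obtain ⟨σ, hσ, hv⟩ := hΔ v
  unfold cone PointedCone.hull at hv
  rw [Submodule.mem_span_image_finset_iff_exists_fun] at hv
  obtain ⟨c, hc⟩ := hv
  refine ⟨fun i => if h : i ∈ σ then (c ⟨i, h⟩ : ℚ) else 0, ?_, ?_, ?_⟩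
  · intro i
    by_cases h : i ∈ σ
    · simpa [h] using (c ⟨i, h⟩).2
    · simp [h]
  · refine Δ.mem_of_subset σ hσ _ ?_
    intro i hi
    by_contra h
    simp [h] at hi
  · rw [← hc, ← Finset.sum_subset (Finset.subset_univ σ) (by intro i _ h; simp [h]),
      ← Finset.sum_coe_sort σ]
    exact Finset.sum_congr rfl fun i _ => by simp

/-- The coefficients `c_ρ` with `v = ∑_{ρ ∈ γ(1)} c_ρ u_ρ`, `c_ρ > 0`, where `γ` is the cone of the fan
that contains `v` in its relative interior, and `c_ρ = 0` for `ρ ∉ γ(1)`. (They are unique.) -/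
def coeff (hΔ : Δ.IsComplete) (v : ℚ ⊗[ℤ] N) : Fin (n + 1) → ℚ := (hΔ.exists_coeff v).choose

/-- The coefficient vector `(b'_0, …, b'_n)` of the primitive relation of `I`,
`∑_{ρ ∈ I} u_ρ - ∑_{ρ ∈ γ(1)} c_ρ u_ρ = 0`. -/
def relationCoeff (hΔ : Δ.IsComplete) (I : Finset (Fin (n + 1))) (i : Fin (n + 1)) : ℚ :=
  (if i ∈ I then 1 else 0) - coeff hΔ (∑ i ∈ I, Δ.rayQ i) i

/-- The least positive integer that clears the denominators of `(b'_0, …, b'_n)`. -/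
def relationDen (hΔ : Δ.IsComplete) (I : Finset (Fin (n + 1))) : ℕ :=
  Finset.univ.lcm fun i => (relationCoeff hΔ I i).den

/-- The integral vector `(b_0, …, b_n)` obtained from `(b'_0, …, b'_n)` by minimally clearing
denominators. -/
def intCoeff (hΔ : Δ.IsComplete) (I : Finset (Fin (n + 1))) (i : Fin (n + 1)) : ℤ :=
  ((relationDen hΔ I : ℚ) * relationCoeff hΔ I i).num

theorem intCoeff_cast (hΔ : Δ.IsComplete) (I : Finset (Fin (n + 1))) (i : Fin (n + 1)) :
    (intCoeff hΔ I i : ℚ) = (relationDen hΔ I : ℚ) * relationCoeff hΔ I i := by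
  obtain ⟨t, ht⟩ : (relationCoeff hΔ I i).den ∣ relationDen hΔ I :=
    Finset.dvd_lcm (f := fun i => (relationCoeff hΔ I i).den) (Finset.mem_univ i)
  have h : (relationDen hΔ I : ℚ) * relationCoeff hΔ I i
      = ((t * (relationCoeff hΔ I i).num : ℤ) : ℚ) := by
    rw [ht]
    push_cast
    have := Rat.mul_den_eq_num (relationCoeff hΔ I i)
    linear_combination (t : ℚ) * this
  unfold intCoeff
  rw [h, Rat.num_intCast]

theorem sum_relationCoeff (hΔ : Δ.IsComplete) (I : Finset (Fin (n + 1))) :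
    ∑ i, relationCoeff hΔ I i • Δ.rayQ i = 0 := by
  have h := (hΔ.exists_coeff (∑ i ∈ I, Δ.rayQ i)).choose_spec.2.2
  simp only [relationCoeff, sub_smul, Finset.sum_sub_distrib, ite_smul, one_smul, zero_smul,
    Finset.sum_ite_mem, Finset.univ_inter]
  rw [sub_eq_zero]
  exact h

theorem sum_intCoeff (hΔ : Δ.IsComplete) (I : Finset (Fin (n + 1))) (m : N →ₗ[ℤ] ℤ) :
    ∑ i, intCoeff hΔ I i * m (Δ.ray i) = 0 := by
  let L : ℚ ⊗[ℤ] N →ₗ[ℚ] ℚ :=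
    (TensorProduct.AlgebraTensorModule.rid ℤ ℚ ℚ).toLinearMap ∘ₗ m.baseChange ℚ
  have hL : ∀ i, L (Δ.rayQ i) = (m (Δ.ray i) : ℚ) := by
    intro i
    simp [L, rayQ]
  have h := congrArg L (sum_relationCoeff hΔ I)
  simp only [map_sum, map_smul, hL, map_zero, smul_eq_mul] at h
  have h2 : ((∑ i, intCoeff hΔ I i * m (Δ.ray i) : ℤ) : ℚ) = 0 := by
    push_cast
    simp only [intCoeff_cast, mul_assoc]
    rw [← Finset.mul_sum, h, mul_zero]
  exact_mod_cast h2

/-- The functional `deg_I : Cl(X) → ℤ`, determined by `deg_I(x_i) = b_i`. -/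
def degI (hΔ : Δ.IsComplete) (I : Finset (Fin (n + 1))) : Δ.ClassGroup →+ ℤ :=
  QuotientAddGroup.lift Δ.charDivisor.range
    (∑ i, (AddMonoidHom.mulLeft (intCoeff hΔ I i)).comp (Pi.evalAddMonoidHom (fun _ => ℤ) i)) (by
      rintro _ ⟨m, rfl⟩
      simpa [charDivisor] using sum_intCoeff hΔ I m)

end SimplicialFan

/-! ### Graded local cohomology and `0`-regularity over a weighted polynomial ring -/

namespace WeightedReg

section

variable (k : Type*) [Field k] {ι : Type*} (d : ι → ℤ)
  (M : Type*) [AddCommGroup M] [Module (MvPolynomial ι k) M]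

/-- The multiplicative set of the monomials in the variables `x_i`, `i ∈ T`. -/
def monomials (T : Finset ι) : Submonoid (MvPolynomial ι k) :=
  Submonoid.closure (MvPolynomial.X '' (T : Set ι))

theorem monomials_erase_le [DecidableEq ι] (T : Finset ι) (i : ι) :
    monomials k (T.erase i) ≤ monomials k T :=
  Submonoid.closure_mono (Set.image_mono (by simp))

/-- The localization `M[x_i⁻¹ : i ∈ T]`. -/
abbrev Loc (T : Finset ι) : Type _ := LocalizedModule (monomials k T) M

/-- The Čech differential on `∏_T M[x_i⁻¹ : i ∈ T]`, with
`(δ c)_T = ∑_{i ∈ T} (-1)^{#{j ∈ T : j < i}} c_{T ∖ i}`. It raises the cohomological degree `#T` by one. -/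
def cechDiff [LinearOrder ι] :
    ((T : Finset ι) → Loc k M T) →ₗ[MvPolynomial ι k] ((T : Finset ι) → Loc k M T) :=
  LinearMap.pi fun T => ∑ i ∈ T, ((-1 : ℤ) ^ (T.filter (· < i)).card) •
    (LocalizedModule.liftOfLE (monomials k (T.erase i)) (monomials k T)
      (monomials_erase_le k T i) (M := M)).comp (LinearMap.proj (T.erase i))

variable {M} (𝓜 : ℤ → AddSubgroup M)

/-- The part of degree `e` of `M[x_i⁻¹ : i ∈ T]`, for a `ℤ`-graded module `M` over `k[x_i]` with
`deg x_i = d i`: it consists of the fractions `m / s` with `deg m - deg s = e`. -/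
def locDegree (T : Finset ι) (e : ℤ) : AddSubgroup (Loc k M T) :=
  AddSubgroup.closure {x | ∃ (s : monomials k T) (e' : ℤ) (m : M),
    MvPolynomial.IsWeightedHomogeneous d (s : MvPolynomial ι k) e' ∧ m ∈ 𝓜 (e + e') ∧
      x = LocalizedModule.mk m s}

/-- The Čech cochains of cohomological degree `p` and internal degree `e`. -/
def cochains (p e : ℤ) : AddSubgroup ((T : Finset ι) → Loc k M T) :=
  AddSubgroup.pi Set.univ fun T => if (T.card : ℤ) = p then locDegree k d 𝓜 T e else ⊥

/-- The Čech cocycles of cohomological degree `p` and internal degree `e`. -/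
def cocycles [LinearOrder ι] (p e : ℤ) : AddSubgroup ((T : Finset ι) → Loc k M T) :=
  cochains k d 𝓜 p e ⊓ (cechDiff k M).toAddMonoidHom.ker

/-- The Čech coboundaries of cohomological degree `p` and internal degree `e`. -/
def coboundaries [LinearOrder ι] (p e : ℤ) : AddSubgroup ((T : Finset ι) → Loc k M T) :=
  (cochains k d 𝓜 (p - 1) e).map (cechDiff k M).toAddMonoidHom

/-- The part `(H^p_B M)_e` of degree `e` of the local cohomology of the `ℤ`-graded module `M` over
`k[x_i : i ∈ ι]`, `deg x_i = d i`, with support in `B = ⟨x_i : i ∈ ι⟩`. -/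
abbrev LocalCohomology [LinearOrder ι] (p e : ℤ) : Type _ :=
  cocycles k d 𝓜 p e ⧸ (coboundaries k d 𝓜 p e).addSubgroupOf (cocycles k d 𝓜 p e)

end

/-- The number `w^j`: the sum of the `j` largest of the degrees `d i` if `0 ≤ j ≤ #ι`, with the
conventions `w^j = -1` for `j < 0` and `w^j = w^{#ι} + 1` for `j > #ι`. -/
def topWeight {ι : Type*} [Fintype ι] (d : ι → ℤ) (j : ℤ) : ℤ :=
  if j < 0 then -1
  else if h : j.toNat ≤ (Finset.univ : Finset ι).card then
    (Finset.powersetCard j.toNat (Finset.univ : Finset ι)).sup'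
      (Finset.powersetCard_nonempty.2 h) (fun J => ∑ i ∈ J, d i)
  else (∑ i, d i) + 1

/-- `M` is `0`-regular: `(H^i_B M)_e = 0` for all `i` and all `e ≥ -w^{i-1}`. -/
def IsZeroRegular (k : Type*) [Field k] {ι : Type*} [Fintype ι] [LinearOrder ι] (d : ι → ℤ)
    {M : Type*} [AddCommGroup M] [Module (MvPolynomial ι k) M] (𝓜 : ℤ → AddSubgroup M) : Prop :=
  ∀ (i : ℕ) (e : ℤ), -topWeight d ((i : ℤ) - 1) ≤ e →
    Subsingleton (LocalCohomology k d 𝓜 (i : ℤ) e)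

end WeightedReg

namespace SimplicialFan

variable {N : Type*} [AddCommGroup N] {n : ℕ} {Δ : SimplicialFan N n}

/-- The degrees `deg_I(x_i)`, `i ∈ I`, of the variables of `S_I = k[x_i : i ∈ I]`. -/
def weightI (hΔ : Δ.IsComplete) (I : Finset (Fin (n + 1))) (i : I) : ℤ :=
  degI hΔ I (Δ.varDegree i)

/-- The structure of an `S_I`-module on an `S`-module, by restriction along
`S_I = k[x_i : i ∈ I] ⊆ S`. -/
abbrev restrictModule (k : Type*) [Field k] (I : Finset (Fin (n + 1))) (M : Type*)
    [AddCommGroup M] [Module (MvPolynomial (Fin (n + 1)) k) M] : Module (MvPolynomial I k) M :=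
  Module.compHom M
    (MvPolynomial.rename (R := k) (Subtype.val : I → Fin (n + 1))).toRingHom

/-- The `ℤ`-grading induced by a `Cl(X)`-grading and the functional `deg_I`:
the part of degree `e` is the sum of the parts of degree `a` with `deg_I(a) = e`. -/
def gradingI (hΔ : Δ.IsComplete) (I : Finset (Fin (n + 1))) {M : Type*} [AddCommGroup M]
    (ℳ : Δ.ClassGroup → AddSubgroup M) (e : ℤ) : AddSubgroup M :=
  ⨆ a : {a : Δ.ClassGroup // degI hΔ I a = e}, ℳ a

/-- `(H^p_{B_I} M_I)_e`, where `M_I` is the graded `S`-module `M`, considered as a `ℤ`-graded module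
over `S_I = k[x_i : i ∈ I]` through `deg_I`, and `B_I = ⟨x_i : i ∈ I⟩ ⊆ S_I`. -/
def LocalCohomologyI (k : Type*) [Field k] (hΔ : Δ.IsComplete) (I : Finset (Fin (n + 1)))
    {M : Type*} [AddCommGroup M] [Module (MvPolynomial (Fin (n + 1)) k) M]
    (ℳ : Δ.ClassGroup → AddSubgroup M) (p e : ℤ) : Type _ :=
  letI : Module (MvPolynomial I k) M := restrictModule k I M
  WeightedReg.LocalCohomology k (weightI hΔ I) (gradingI hΔ I ℳ) p e

/-- `M` is `deg_I` `0`-regular: the `ℤ`-graded `S_I`-module `M_I` is `0`-regular. -/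
def IsDegIZeroRegular (k : Type*) [Field k] (hΔ : Δ.IsComplete) (I : Finset (Fin (n + 1)))
    {M : Type*} [AddCommGroup M] [Module (MvPolynomial (Fin (n + 1)) k) M]
    (ℳ : Δ.ClassGroup → AddSubgroup M) : Prop :=
  letI : Module (MvPolynomial I k) M := restrictModule k I M
  WeightedReg.IsZeroRegular k (weightI hΔ I) (gradingI hΔ I ℳ)

/-- The number `w_I^j`: the largest sum of the `deg_I`-degrees of `j` distinct variables `x_i`, `i ∈ I`,
for `0 ≤ j ≤ #I`, and `w_I^j = w_I^{#I} + 1` for `j > #I`. -/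
def wI (hΔ : Δ.IsComplete) (I : Finset (Fin (n + 1))) (j : ℤ) : ℤ :=
  WeightedReg.topWeight (weightI hΔ I) j

end SimplicialFan

/-! ### Minimal graded free resolutions -/

/-- A minimal graded free resolution `F_0 ← F_1 ← ⋯` of a graded module `M` over `S = k[x_i : i ∈ σ]`,
where `S` is graded by an abelian group `A` through `deg x_i = w i`. Here `F_j` is the free module
with a homogeneous basis `gen j`, that is, `F_j = ⨁_b S(-deg b)`. -/
structure MinimalFreeResolution {k : Type*} [Field k] {σ A : Type*} [AddCommGroup A] (w : σ → A)
    {M : Type*} [AddCommGroup M] [Module (MvPolynomial σ k) M] (ℳ : A → AddSubgroup M) where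
  /-- the generators of `F_j` -/
  gen : ℕ → Type*
  /-- the degrees of the generators -/
  deg : (j : ℕ) → gen j → A
  /-- the differential `F_{j+1} → F_j` -/
  diff : (j : ℕ) → (gen (j + 1) →₀ MvPolynomial σ k) →ₗ[MvPolynomial σ k]
    (gen j →₀ MvPolynomial σ k)
  /-- the augmentation `F_0 → M` -/
  aug : (gen 0 →₀ MvPolynomial σ k) →ₗ[MvPolynomial σ k] M
  /-- the differentials are homogeneous of degree `0` -/
  diff_homogeneous : ∀ j b c, MvPolynomial.IsWeightedHomogeneous w
    (diff j (Finsupp.single b 1) c) (deg (j + 1) b - deg j c)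
  /-- the augmentation is homogeneous of degree `0` -/
  aug_homogeneous : ∀ b, aug (Finsupp.single b 1) ∈ ℳ (deg 0 b)
  aug_surjective : Function.Surjective aug
  exact_zero : Function.Exact (diff 0) aug
  exact_succ : ∀ j, Function.Exact (diff (j + 1)) (diff j)
  /-- minimality: the differentials map into `𝔪 F_j`, where `𝔪` is generated by the variables -/
  minimal : ∀ j, LinearMap.range (diff j) ≤
    Ideal.span (Set.range (MvPolynomial.X : σ → MvPolynomial σ k)) • ⊤

end

/-! A generator of $F_j$ of degree $a$ is a class in $\operatorname{Tor}_j(M,k)_a$, that is, in the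
Koszul homology of all variables with coefficients in $M$. So it is enough that this homology
vanishes in homological degree $j$ once $\deg_I(a)\ge w_I^{j+1}$. No Tor is formed: a zigzag through
$F\otimes K$ (`MinimalFreeResolution.not_koszul_exact`) shows that such vanishing would put a basis
element of $F_j$ into $\mathfrak m F_j$.

For the variables in $I$ alone, Koszul homology is controlled by local cohomology. In the double
complex of Čech and Koszul complexes, every localization at a nonempty set of variables is Koszul
acyclic, because some variable has become invertible. A second zigzag
(`WeightedReg.acyclic_of_localCohomology`) then gives $H_q(x_I;M)_e=0$ as soon as $H^p_{B_I}(M_I)$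
vanishes in degree $e-\sum_{i\in J}b_i$ for all $p$ and all $J\subseteq I$ with $\#J=q+p$. For
$p\ge1$ such a $J$ splits into $q+1$ and $p-1$ elements, so $\sum_J b_i\le w_I^{q+1}+w_I^{p-1}$, and
$e\ge w_I^{q+1}$ lands in the range of $0$-regularity; for $p=0$ the strict inequality
$w_I^q<w_I^{q+1}$ does it. This uses $b_i>0$ on $I$, which is where primitivity of the collection
enters.

The variables outside $I$ have $b_i\le0$. Adjoining one, the sequence $H_q(T)_e\to H_q(T\cup i)_e\to
H_{q-1}(T)_{e-b_i}$ raises the degree and lowers the required bound, so vanishing persists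
(`Koszul.acyclic_union`). The second estimate is the same argument with the constant bound
$w_I^{\#I}$; the only degree not covered by regularity is then $(H^0)_0$. -/

noncomputable section

set_option linter.unusedSectionVars false

/-! ### Koszul complexes as functions on finite sets of indices -/

namespace Koszul

variable {κ M : Type*} [LinearOrder κ] [AddCommGroup M]

/-- The sign of the position of `i` in `J`. -/
def sgn (i : κ) (J : Finset κ) : ℤ := (-1) ^ (J.filter (· < i)).card

theorem sgn_mul_self (i : κ) (J : Finset κ) : sgn i J * sgn i J = 1 := by
  rw [sgn, ← mul_pow]; simp

theorem sgn_insert {i j : κ} {J : Finset κ} (hj : j ∉ J) :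
    sgn i (insert j J) = if j < i then -sgn i J else sgn i J := by
  unfold sgn
  rw [Finset.filter_insert]
  split_ifs with h
  · rw [Finset.card_insert_of_notMem (by simp [hj]), pow_succ]; ring
  · rfl

theorem sgn_erase_self (i : κ) (J : Finset κ) : sgn i (J.erase i) = sgn i J := by
  unfold sgn
  congr 2
  ext j
  simp only [Finset.mem_filter, Finset.mem_erase]
  constructor
  · rintro ⟨⟨_, h⟩, h'⟩; exact ⟨h, h'⟩
  · rintro ⟨h, h'⟩; exact ⟨⟨h'.ne, h⟩, h'⟩

theorem sgn_insert_self (i : κ) (J : Finset κ) : sgn i (insert i J) = sgn i J := by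
  rw [← sgn_erase_self i (insert i J), ← sgn_erase_self i J, Finset.erase_insert_eq_erase]

theorem sgn_anticomm {i j : κ} {J : Finset κ} (hij : i ≠ j) (hi : i ∉ J) (hj : j ∉ J) :
    sgn i J * sgn j (insert i J) = -(sgn j J * sgn i (insert j J)) := by
  rw [sgn_insert hi, sgn_insert hj]
  rcases lt_or_gt_of_ne hij with h | h
  · rw [if_pos h, if_neg h.not_gt]; ring
  · rw [if_neg h.not_gt, if_pos h]; ring

/-- Contraction with the `i`-th coordinate on `M ⊗ ⋀ ℤ^κ`; an element `∑_J y_J e_J` is given by the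
function `J ↦ y_J`. -/
def contr (i : κ) : (Finset κ → M) →+ (Finset κ → M) where
  toFun y J := if i ∈ J then 0 else sgn i J • y (insert i J)
  map_zero' := by ext; simp
  map_add' y z := by ext J; by_cases h : i ∈ J <;> simp [h]

/-- Left multiplication by `e_i` on `M ⊗ ⋀ ℤ^κ`. -/
def wedge (i : κ) : (Finset κ → M) →+ (Finset κ → M) where
  toFun y J := if i ∈ J then sgn i J • y (J.erase i) else 0
  map_zero' := by ext; simp
  map_add' y z := by ext J; by_cases h : i ∈ J <;> simp [h]

theorem contr_apply (i : κ) (y : Finset κ → M) (J : Finset κ) :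
    contr i y J = if i ∈ J then 0 else sgn i J • y (insert i J) := rfl

theorem wedge_apply (i : κ) (y : Finset κ → M) (J : Finset κ) :
    wedge i y J = if i ∈ J then sgn i J • y (J.erase i) else 0 := rfl

theorem contr_contr_self (i : κ) (y : Finset κ → M) : contr i (contr i y) = 0 := by
  ext J
  by_cases h : i ∈ J <;> simp [contr_apply, h]

theorem contr_anticomm (i j : κ) (y : Finset κ → M) :
    contr i (contr j y) + contr j (contr i y) = 0 := by
  rcases eq_or_ne i j with rfl | hij
  · rw [contr_contr_self, add_zero]
  ext J
  by_cases hi : i ∈ J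
  · simp [contr_apply, hi]
  by_cases hj : j ∈ J
  · simp [contr_apply, hj]
  · simp only [Pi.add_apply, contr_apply, hi, hj, Finset.mem_insert, hij, hij.symm, or_self,
      if_false, smul_smul, Pi.zero_apply]
    rw [sgn_anticomm hij hi hj, Finset.insert_comm, neg_smul, neg_add_cancel]

/-- The Clifford relation. It splits a chain into the part without $e_i$ and the part divisible by
$e_i$. -/
theorem contr_wedge_self (i : κ) (y : Finset κ → M) :
    contr i (wedge i y) + wedge i (contr i y) = y := by
  ext J
  by_cases hi : i ∈ J
  · simp [contr_apply, wedge_apply, hi, smul_smul, sgn_erase_self, sgn_mul_self]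
  · simp [contr_apply, wedge_apply, hi, smul_smul, sgn_insert_self, sgn_mul_self]

theorem contr_wedge_of_ne {i j : κ} (hij : i ≠ j) (y : Finset κ → M) :
    contr i (wedge j y) + wedge j (contr i y) = 0 := by
  ext J
  by_cases hi : i ∈ J
  · by_cases hj : j ∈ J <;> simp [contr_apply, wedge_apply, hi, hj, hij]
  by_cases hj : j ∈ J
  · obtain ⟨K, hK, rfl⟩ : ∃ K, j ∉ K ∧ insert j K = J :=
      ⟨J.erase j, by simp, Finset.insert_erase hj⟩
    have hiK : i ∉ K := fun h => hi (Finset.mem_insert_of_mem h)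
    have h1 : (insert i (insert j K)).erase j = insert i K := by
      rw [Finset.insert_comm, Finset.erase_insert (by simp [hK, hij.symm])]
    simp only [Pi.add_apply, contr_apply, wedge_apply, hi, hiK, if_false, Finset.mem_insert,
      true_or, or_true, if_true, Finset.erase_insert hK, h1, smul_smul, Pi.zero_apply]
    rw [Finset.insert_comm, sgn_insert_self j K, sgn_insert_self j (insert i K),
      mul_comm (sgn i _), ← add_smul]
    have h2 := sgn_insert (i := i) hK
    have h3 := sgn_insert (i := j) hiK
    rcases lt_or_gt_of_ne hij with h | h
    · rw [h2, h3, if_pos h, if_neg h.not_gt]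
      ring_nf; simp
    · rw [h2, h3, if_neg h.not_gt, if_pos h]
      ring_nf; simp
  · simp [contr_apply, wedge_apply, hi, hj, hij.symm]

/-- Terms cancel in pairs under swapping the indices. The diagonal is a separate condition because
$M$ may have 2-torsion. Both the Koszul and the Čech differential square to zero by this. -/
theorem sum_sum_eq_zero_of_antisymm {α : Type*} (T : Finset α) (f : α → α → M)
    (hd : ∀ i ∈ T, f i i = 0) (ha : ∀ i ∈ T, ∀ j ∈ T, f i j + f j i = 0) :
    ∑ i ∈ T, ∑ j ∈ T, f i j = 0 := by
  classical
  rw [← Finset.sum_product']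
  refine Finset.sum_involution (fun p _ => (p.2, p.1)) ?_ ?_ ?_ ?_
  · rintro ⟨i, j⟩ h
    rw [Finset.mem_product] at h
    exact ha i h.1 j h.2
  · rintro ⟨i, j⟩ h hne heq
    rw [Finset.mem_product] at h
    simp only [Prod.mk.injEq] at heq
    apply hne
    obtain rfl : j = i := heq.1
    exact hd _ h.1
  · rintro ⟨i, j⟩ h
    rw [Finset.mem_product] at h ⊢
    exact ⟨h.2, h.1⟩
  · rintro ⟨i, j⟩ _
    rfl

variable {R : Type*} [CommRing R] [Module R M]

theorem contr_smul (i : κ) (r : R) (y : Finset κ → M) : contr i (r • y) = r • contr i y := by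
  ext J
  by_cases h : i ∈ J <;> simp [contr_apply, h, smul_comm r]

theorem wedge_smul (i : κ) (r : R) (y : Finset κ → M) : wedge i (r • y) = r • wedge i y := by
  ext J
  by_cases h : i ∈ J <;> simp [wedge_apply, h, smul_comm r]

/-- The differential of the Koszul complex of the elements `x_i`, `i ∈ T`, with coefficients in `M`. -/
def diff (x : κ → R) (T : Finset κ) : (Finset κ → M) →ₗ[R] (Finset κ → M) where
  toFun y := ∑ i ∈ T, x i • contr i y
  map_add' y z := by simp [Finset.sum_add_distrib]
  map_smul' r y := by
    simp only [contr_smul, Finset.smul_sum, RingHom.id_apply]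
    exact Finset.sum_congr rfl fun i _ => smul_comm _ _ _

theorem diff_apply (x : κ → R) (T : Finset κ) (y : Finset κ → M) :
    diff x T y = ∑ i ∈ T, x i • contr i y := rfl

theorem diff_diff (x : κ → R) (T : Finset κ) (y : Finset κ → M) : diff x T (diff x T y) = 0 := by
  simp only [diff_apply, map_sum, contr_smul]
  refine sum_sum_eq_zero_of_antisymm T _ (fun i _ => ?_) fun i _ j _ => ?_
  · rw [contr_contr_self, smul_zero, smul_zero]
  · rw [smul_comm (x j), ← smul_add, ← smul_add, contr_anticomm, smul_zero, smul_zero]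

theorem contr_diff (x : κ → R) (T : Finset κ) (i : κ) (y : Finset κ → M) :
    contr i (diff x T y) = -diff x T (contr i y) := by
  rw [eq_neg_iff_add_eq_zero, diff_apply, diff_apply, map_sum, ← Finset.sum_add_distrib]
  refine Finset.sum_eq_zero fun j _ => ?_
  rw [contr_smul, ← smul_add, contr_anticomm, smul_zero]

/-- Multiplication by $e_i$ is a homotopy from multiplication by $x_i$ to zero; all acyclicity
statements rest on this. -/
theorem diff_wedge (x : κ → R) {T : Finset κ} {i : κ} (hi : i ∈ T) (y : Finset κ → M) :
    diff x T (wedge i y) = x i • y - wedge i (diff x T y) := by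
  rw [eq_sub_iff_add_eq, diff_apply, diff_apply, map_sum, ← Finset.sum_add_distrib,
    Finset.sum_eq_single i]
  · rw [wedge_smul, ← smul_add, contr_wedge_self]
  · intro j _ hj
    rw [wedge_smul, ← smul_add, contr_wedge_of_ne hj, smul_zero]
  · exact fun h => absurd hi h

theorem diff_insert (x : κ → R) {T : Finset κ} {i : κ} (hi : i ∉ T) (y : Finset κ → M) :
    diff x (insert i T) y = x i • contr i y + diff x T y :=
  Finset.sum_insert hi

/-- Functoriality of the Koszul complex. -/
def map {M' : Type*} [AddCommGroup M'] [Module R M'] (f : M →ₗ[R] M') :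
    (Finset κ → M) →ₗ[R] (Finset κ → M') := f.compLeft _

theorem map_apply {M' : Type*} [AddCommGroup M'] [Module R M'] (f : M →ₗ[R] M')
    (y : Finset κ → M) (J : Finset κ) : map f y J = f (y J) := rfl

theorem map_contr {M' : Type*} [AddCommGroup M'] [Module R M'] (f : M →ₗ[R] M') (i : κ)
    (y : Finset κ → M) : map f (contr i y) = contr i (map f y) := by
  ext J
  by_cases h : i ∈ J <;> simp [map_apply, contr_apply, h]

theorem map_diff {M' : Type*} [AddCommGroup M'] [Module R M'] (f : M →ₗ[R] M') (x : κ → R)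
    (T : Finset κ) (y : Finset κ → M) : map f (diff x T y) = diff x T (map f y) := by
  simp only [diff_apply, map_sum, map_smul, map_contr]

/-! ### Homogeneous chains -/

variable {A : Type*} [AddCommGroup A]

/-- The Koszul chain `y` of the variables in `T` is homogeneous of homological degree `q` and
internal degree `a`. -/
structure IsHomog (w : κ → A) (𝓖 : A → AddSubgroup M) (T : Finset κ) (q : ℕ) (a : A)
    (y : Finset κ → M) : Prop where
  mem : ∀ J, y J ∈ 𝓖 (a - ∑ i ∈ J, w i)
  supp : ∀ J, y J ≠ 0 → J ⊆ T ∧ J.card = q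

variable {w : κ → A} {𝓖 : A → AddSubgroup M} {T : Finset κ} {q : ℕ} {a : A} {y z : Finset κ → M}

namespace IsHomog

theorem zero : IsHomog w 𝓖 T q a 0 := ⟨fun _ => zero_mem _, fun _ h => absurd rfl h⟩

theorem add (hy : IsHomog w 𝓖 T q a y) (hz : IsHomog w 𝓖 T q a z) :
    IsHomog w 𝓖 T q a (y + z) := by
  refine ⟨fun J => add_mem (hy.mem J) (hz.mem J), fun J h => ?_⟩
  by_cases h' : y J = 0
  · exact hz.supp J fun h'' => h (by simp [h', h''])
  · exact hy.supp J h'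

theorem neg (hy : IsHomog w 𝓖 T q a y) : IsHomog w 𝓖 T q a (-y) :=
  ⟨fun J => neg_mem (hy.mem J), fun J h => hy.supp J fun h' => h (by simp [h'])⟩

theorem sub (hy : IsHomog w 𝓖 T q a y) (hz : IsHomog w 𝓖 T q a z) :
    IsHomog w 𝓖 T q a (y - z) := sub_eq_add_neg y z ▸ hy.add hz.neg

theorem sum {α : Type*} {s : Finset α} {f : α → Finset κ → M}
    (h : ∀ i ∈ s, IsHomog w 𝓖 T q a (f i)) : IsHomog w 𝓖 T q a (∑ i ∈ s, f i) :=
  Finset.sum_induction f _ (fun _ _ => add) zero h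

theorem mono {T' : Finset κ} (hT : T ⊆ T') (hy : IsHomog w 𝓖 T q a y) : IsHomog w 𝓖 T' q a y :=
  ⟨hy.mem, fun J h => ⟨(hy.supp J h).1.trans hT, (hy.supp J h).2⟩⟩

theorem smul {r : R} {b : A} (hr : ∀ e, ∀ m ∈ 𝓖 e, r • m ∈ 𝓖 (e + b)) (hy : IsHomog w 𝓖 T q a y) :
    IsHomog w 𝓖 T q (a + b) (r • y) := by
  refine ⟨fun J => ?_, fun J h => hy.supp J fun h' => h (by simp [h'])⟩
  have := hr _ _ (hy.mem J)
  rwa [sub_add_eq_add_sub] at this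

theorem contr {i : κ} (hy : IsHomog w 𝓖 (insert i T) (q + 1) a y) :
    IsHomog w 𝓖 T q (a - w i) (contr i y) := by
  refine ⟨fun J => ?_, fun J h => ?_⟩
  · rw [contr_apply]
    split_ifs with h
    · exact zero_mem _
    · refine zsmul_mem ?_ _
      have := hy.mem (insert i J)
      rwa [Finset.sum_insert h, ← sub_sub] at this
  · rw [contr_apply] at h
    split_ifs at h with hi
    · exact absurd rfl h
    · have := hy.supp (insert i J) fun h' => h (by simp [h'])
      rw [Finset.card_insert_of_notMem hi] at this
      exact ⟨(Finset.insert_subset_insert_iff hi).1 this.1, by omega⟩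

theorem wedge {i : κ} (hi : i ∈ T) (hy : IsHomog w 𝓖 T q (a - w i) y) :
    IsHomog w 𝓖 T (q + 1) a (wedge i y) := by
  refine ⟨fun J => ?_, fun J h => ?_⟩
  · rw [wedge_apply]
    split_ifs with h
    · refine zsmul_mem ?_ _
      have := hy.mem (J.erase i)
      rwa [sub_sub, Finset.add_sum_erase _ _ h] at this
    · exact zero_mem _
  · rw [wedge_apply] at h
    split_ifs at h with hJ
    · have := hy.supp (J.erase i) fun h' => h (by simp [h'])
      rw [Finset.card_erase_of_mem hJ] at this
      have h0 := Finset.card_pos.2 ⟨i, hJ⟩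
      refine ⟨fun j hj => ?_, by omega⟩
      rcases eq_or_ne j i with rfl | hne
      · exact hi
      · exact this.1 (Finset.mem_erase.2 ⟨hne, hj⟩)
    · exact absurd rfl h

theorem contr_eq_zero {i : κ} (hi : i ∉ T) (hy : IsHomog w 𝓖 T q a y) : Koszul.contr i y = 0 := by
  ext J
  rw [contr_apply]
  split_ifs with h
  · rfl
  · by_contra h0
    exact hi ((hy.supp (insert i J) fun h' => h0 (by simp [h'])).1 (Finset.mem_insert_self i J))

theorem diff_zero (x : κ → R) (hy : IsHomog w 𝓖 T 0 a y) (T' : Finset κ) :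
    Koszul.diff x T' y = 0 := by
  rw [diff_apply]
  refine Finset.sum_eq_zero fun i _ => ?_
  suffices Koszul.contr i y = 0 by rw [this, smul_zero]
  ext J
  rw [contr_apply]
  split_ifs with h
  · rfl
  · by_contra h0
    have := (hy.supp (insert i J) fun h' => h0 (by simp [h'])).2
    simp at this

theorem map {M' : Type*} [AddCommGroup M'] [Module R M'] {𝓖' : A → AddSubgroup M'}
    {f : M →ₗ[R] M'} {b : A} (hf : ∀ e, ∀ m ∈ 𝓖 e, f m ∈ 𝓖' (e + b)) (hy : IsHomog w 𝓖 T q a y) :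
    IsHomog w 𝓖' T q (a + b) (Koszul.map f y) := by
  refine ⟨fun J => ?_, fun J h => hy.supp J fun h' => h (by simp [map_apply, h'])⟩
  have := hf _ _ (hy.mem J)
  rwa [sub_add_eq_add_sub] at this

theorem diff {x : κ → R} (hx : ∀ i ∈ T, ∀ e, ∀ m ∈ 𝓖 e, x i • m ∈ 𝓖 (e + w i))
    (hy : IsHomog w 𝓖 T (q + 1) a y) : IsHomog w 𝓖 T q a (Koszul.diff x T y) := by
  rw [diff_apply]
  refine sum fun i hi => ?_
  rw [← sub_add_cancel a (w i)]
  refine IsHomog.smul (hx i hi) (IsHomog.contr ?_)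
  rwa [Finset.insert_eq_of_mem hi]

end IsHomog

end Koszul

/-! ### Vanishing of Koszul homology -/

namespace Koszul

variable {κ M : Type*} [LinearOrder κ] [AddCommGroup M]
variable {R : Type*} [CommRing R] [Module R M]
variable {A : Type*} [AddCommGroup A]
variable {w : κ → A} {𝓖 : A → AddSubgroup M} {T : Finset κ} {q : ℕ} {a : A} {y z : Finset κ → M}

/-- The homology of the Koszul complex of the `x_i`, `i ∈ T`, with coefficients in `M` vanishes in
homological degree `q` and internal degree `a`. -/
def Acyclic (w : κ → A) (x : κ → R) (𝓖 : A → AddSubgroup M) (T : Finset κ) (q : ℕ) (a : A) : Prop :=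
  ∀ y, IsHomog w 𝓖 T q a y → diff x T y = 0 → ∃ t, IsHomog w 𝓖 T (q + 1) a t ∧ diff x T t = y

theorem IsHomog.diff_insert_of_notMem {x : κ → R} {i : κ} (hi : i ∉ T) (hy : IsHomog w 𝓖 T q a y) :
    Koszul.diff x (insert i T) y = Koszul.diff x T y := by
  rw [diff_insert x hi, hy.contr_eq_zero hi, smul_zero, zero_add]

/-- What remains after removing the part divisible by $e_i$ equals $\iota_i(e_i\wedge y)$, so it
involves only $T$. -/
theorem IsHomog.sub_wedge_contr {i : κ} (hy : IsHomog w 𝓖 (insert i T) (q + 1) a y) :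
    IsHomog w 𝓖 T (q + 1) a (y - Koszul.wedge i (Koszul.contr i y)) := by
  have h := hy.sub (hy.contr.mono (Finset.subset_insert i T) |>.wedge (Finset.mem_insert_self i T))
  refine ⟨h.mem, fun J hJ => ?_⟩
  have hJ' := h.supp J hJ
  refine ⟨?_, hJ'.2⟩
  have hiJ : i ∉ J := fun hiJ => by
    rw [← eq_sub_iff_add_eq.2 (contr_wedge_self i y), contr_apply, if_pos hiJ] at hJ
    exact hJ rfl
  exact (Finset.subset_insert_iff_of_notMem hiJ).1 hJ'.1

/-- Adding the element `x_i` to a Koszul complex: vanishing in homological degree `q + 1`. -/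
theorem Acyclic.insert {x : κ → R} {i : κ} (hi : i ∉ T)
    (hx : ∀ e, ∀ m ∈ 𝓖 e, x i • m ∈ 𝓖 (e + w i)) (h : Acyclic w x 𝓖 T (q + 1) a)
    (h' : ∀ b z, IsHomog w 𝓖 T q (a - w i) b → diff x T b = 0 →
      IsHomog w 𝓖 T (q + 1) a z → diff x T z = x i • b →
      ∃ c, IsHomog w 𝓖 T (q + 1) (a - w i) c ∧ diff x T c = b) :
    Acyclic w x 𝓖 (insert i T) (q + 1) a := by
  intro y hy hdy
  have hiT := Finset.mem_insert_self i T
  have hb := hy.contr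
  have hb0 : diff x T (contr i y) = 0 := by
    rw [← hb.diff_insert_of_notMem hi, ← neg_eq_zero, ← contr_diff, hdy, map_zero]
  have ha := hy.sub_wedge_contr
  have ha0 : diff x T (y - wedge i (contr i y)) = -(x i • contr i y) := by
    rw [← ha.diff_insert_of_notMem hi, map_sub, hdy, diff_wedge x hiT,
      hb.diff_insert_of_notMem hi, hb0, map_zero, sub_zero, zero_sub]
  -- Write $y=\alpha+e_i\wedge b$ over $T$. Then $db=0$ and $d\alpha=-x_ib$, so the class of $b$ is
  -- killed by $x_i$, witnessed by $-\alpha$. With $dc=b$, the chain $\alpha+x_ic$ is a cycle over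
  -- $T$, hence some $dt$, and $y=d(t-e_i\wedge c)$.
  obtain ⟨c, hc, hcb⟩ := h' _ (-(y - wedge i (contr i y))) hb hb0 ha.neg (by
    rw [map_neg, ha0, neg_neg])
  have hz := ha.add (sub_add_cancel a (w i) ▸ hc.smul hx)
  obtain ⟨t, ht, htz⟩ := h _ hz (by
    rw [map_add, ha0, map_smul, hcb, neg_add_cancel])
  refine ⟨t - wedge i c, (ht.mono (Finset.subset_insert i T)).sub
    ((hc.mono (Finset.subset_insert i T)).wedge hiT), ?_⟩
  rw [map_sub, ht.diff_insert_of_notMem hi, htz, diff_wedge x hiT, hc.diff_insert_of_notMem hi, hcb]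
  abel

/-- Exactness of $H_{q+1}(T)_a\to H_{q+1}(T\cup i)_a\to H_q(T)_{a-w_i}$ in the middle. -/
theorem Acyclic.insert_of_acyclic {x : κ → R} {i : κ} (hi : i ∉ T)
    (hx : ∀ e, ∀ m ∈ 𝓖 e, x i • m ∈ 𝓖 (e + w i)) (h : Acyclic w x 𝓖 T (q + 1) a)
    (h' : Acyclic w x 𝓖 T q (a - w i)) : Acyclic w x 𝓖 (Insert.insert i T) (q + 1) a :=
  h.insert hi hx fun b _ hb hb0 _ _ => h' b hb hb0

/-- In homological degree zero, enlarging $T$ only passes to a quotient of $M/(x_T)M$. -/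
theorem Acyclic.insert_zero {x : κ → R} {i : κ} (h : Acyclic w x 𝓖 T 0 a) :
    Acyclic w x 𝓖 (Insert.insert i T) 0 a := by
  intro y hy _
  have hy' : IsHomog w 𝓖 T 0 a y := ⟨hy.mem, fun J hJ => by
    have := (hy.supp J hJ).2
    exact ⟨by simp [Finset.card_eq_zero.1 this], this⟩⟩
  obtain ⟨t, ht, hty⟩ := h y hy' (hy'.diff_zero x T)
  by_cases hi : i ∈ T
  · rw [Finset.insert_eq_of_mem hi]; exact ⟨t, ht, hty⟩
  · exact ⟨t, ht.mono (Finset.subset_insert i T), by rw [ht.diff_insert_of_notMem hi, hty]⟩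

/-- The Koszul complex is acyclic if one of its elements acts invertibly. -/
theorem acyclic_of_inverse {x : κ → R} {i : κ} (hi : i ∈ T) (u : M →ₗ[R] M)
    (hu : ∀ m, x i • u m = m) (hu' : ∀ e, ∀ m ∈ 𝓖 e, u m ∈ 𝓖 (e - w i)) :
    Acyclic w x 𝓖 T q a := by
  intro y hy hdy
  refine ⟨wedge i (map u y), ?_, ?_⟩
  · refine IsHomog.wedge hi ?_
    rw [sub_eq_add_neg]
    exact hy.map fun e m hm => sub_eq_add_neg e (w i) ▸ hu' e m hm
  · rw [diff_wedge x hi, ← map_diff, hdy, _root_.map_zero, _root_.map_zero, sub_zero]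
    ext J
    simp [map_apply, hu]

/-! ### Graded free modules over polynomial rings -/

section Free

variable {k : Type*} [Field k] (w) {gen : Type*} (deg : gen → A)

/-- The grading of the free module over `k[x_i : i ∈ κ]` with a basis of elements of degrees `deg b`. -/
def freeGrading (a : A) : AddSubgroup (gen →₀ MvPolynomial κ k) where
  carrier := {f | ∀ b, MvPolynomial.IsWeightedHomogeneous w (f b) (a - deg b)}
  zero_mem' _ := MvPolynomial.isWeightedHomogeneous_zero k w _
  add_mem' hf hg b := (hf b).add (hg b)
  neg_mem' {f} hf b := by
    rw [Finsupp.neg_apply]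
    exact (MvPolynomial.weightedHomogeneousSubmodule k w (a - deg b)).neg_mem (hf b)

variable {w deg}

theorem X_smul_mem_freeGrading (i : κ) (e : A) (f : gen →₀ MvPolynomial κ k)
    (hf : f ∈ freeGrading w deg e) :
    (MvPolynomial.X i : MvPolynomial κ k) • f ∈ freeGrading w deg (e + w i) := by
  intro b
  rw [Finsupp.smul_apply, smul_eq_mul, add_sub_right_comm, add_comm]
  exact (MvPolynomial.isWeightedHomogeneous_X k w i).mul (hf b)

theorem isHomog_single_empty {m : M} (hm : m ∈ 𝓖 a) :
    IsHomog w 𝓖 T 0 a (Pi.single (∅ : Finset κ) m) := by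
  refine ⟨fun J => ?_, fun J hJ => ?_⟩
  · by_cases h : J = ∅
    · subst h; simpa using hm
    · rw [Pi.single_eq_of_ne h]; exact zero_mem _
  · by_cases h : J = ∅
    · subst h; simp
    · rw [Pi.single_eq_of_ne h] at hJ; exact absurd rfl hJ

theorem IsHomog.eq_single_empty (hy : IsHomog w 𝓖 T 0 a y) : y = Pi.single ∅ (y ∅) := by
  ext J
  by_cases h : J = ∅
  · subst h; simp
  · rw [Pi.single_eq_of_ne h]
    by_contra h'
    exact h (Finset.card_eq_zero.1 (hy.supp J h').2)

/-- A homogeneous element of a free module in the submodule generated by the multiples of the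
variables `x_i`, `i ∈ T`, is a Koszul boundary. -/
theorem exists_diff_eq_single {f : gen →₀ MvPolynomial κ k} (hf : f ∈ freeGrading w deg a)
    (hfT : ∀ b, f b ∈ Ideal.span (MvPolynomial.X '' (T : Set κ) : Set (MvPolynomial κ k))) :
    ∃ t, IsHomog w (freeGrading w deg) T 1 a t ∧
      diff (MvPolynomial.X : κ → MvPolynomial κ k) T t = Pi.single ∅ f := by
  let B : AddSubgroup (gen →₀ MvPolynomial κ k) :=
    { carrier := {f | ∃ t, IsHomog w (freeGrading w deg) T 1 a t ∧
        diff (MvPolynomial.X : κ → MvPolynomial κ k) T t = Pi.single ∅ f}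
      zero_mem' := ⟨0, IsHomog.zero, by simp⟩
      add_mem' := by
        rintro f g ⟨t, ht, htf⟩ ⟨s, hs, hsg⟩
        exact ⟨t + s, ht.add hs, by rw [map_add, htf, hsg, Pi.single_add]⟩
      neg_mem' := by
        rintro f ⟨t, ht, htf⟩
        exact ⟨-t, ht.neg, by rw [map_neg, htf, Pi.single_neg]⟩ }
  suffices f ∈ B from this
  rw [← Finsupp.sum_single f]
  refine B.sum_mem fun b _ => ?_
  have : Finsupp.single b (f b) = ∑ m ∈ (f b).support,
      Finsupp.single b (MvPolynomial.monomial m ((f b).coeff m)) := by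
    conv_lhs => rw [(f b).as_sum, ← Finsupp.singleAddHom_apply, map_sum]
    rfl
  rw [this]
  -- For a single monomial divisible by $x_i$, the required chain is $e_i$ times the quotient.
  refine B.sum_mem fun m hm => ?_
  obtain ⟨i, hi, hmi⟩ := MvPolynomial.mem_ideal_span_X_image.1 (hfT b) m hm
  have hmw := hf b (MvPolynomial.mem_support_iff.1 hm)
  obtain ⟨m', rfl⟩ : ∃ m', m = Finsupp.single i 1 + m' :=
    ⟨m - Finsupp.single i 1, (add_tsub_cancel_of_le (by
      rw [Finsupp.single_le_iff]; omega)).symm⟩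
  set r := (f b).coeff (Finsupp.single i 1 + m')
  have hg : Finsupp.single b (MvPolynomial.monomial m' r) ∈ freeGrading w deg (a - w i) := by
    intro c
    by_cases hc : b = c
    · subst hc
      rw [Finsupp.single_eq_same]
      refine MvPolynomial.isWeightedHomogeneous_monomial w m' r ?_
      rw [map_add, Finsupp.weight_single, one_smul] at hmw
      rw [sub_right_comm, ← hmw, add_sub_cancel_left]
    · rw [Finsupp.single_eq_of_ne' hc]
      exact MvPolynomial.isWeightedHomogeneous_zero k w _
  refine ⟨wedge i (Pi.single ∅ (Finsupp.single b (MvPolynomial.monomial m' r))),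
    IsHomog.wedge (w := w) hi (isHomog_single_empty hg), ?_⟩
  rw [diff_wedge _ (Finset.mem_coe.1 hi), (isHomog_single_empty (w := w) (T := T) hg).diff_zero, map_zero, sub_zero,
    ← Pi.single_smul, Finsupp.smul_single, smul_eq_mul, MvPolynomial.X, MvPolynomial.monomial_mul,
    one_mul]

/-- The Koszul complex of variables with coefficients in a free module is acyclic in positive
homological degrees. -/
theorem acyclic_free (T : Finset κ) (q : ℕ) (a : A) :
    Acyclic w (MvPolynomial.X : κ → MvPolynomial κ k) (freeGrading (k := k) w deg) T (q + 1) a := by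
  induction T using Finset.induction_on generalizing q a with
  | empty =>
    intro y hy _
    refine ⟨0, IsHomog.zero, ?_⟩
    rw [map_zero]
    ext1 J
    by_contra h
    have := hy.supp J (Ne.symm h)
    rw [Finset.subset_empty] at this
    simp [this.1] at this
  | insert i T hi ih =>
    refine (ih q a).insert hi (X_smul_mem_freeGrading (k := k) (deg := deg) i) ?_
    -- For $H_1$ the previous $H_0$ does not vanish; instead $x_i$ is a nonzerodivisor modulo the
    -- monomial ideal $(x_T)$, because multiplying a monomial by $x_i$ with $i\notin T$ cannot make
    -- it divisible by a variable in $T$.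
    rcases q with _ | q
    · intro b z hb _ _ hzb
      rw [hb.eq_single_empty]
      refine exists_diff_eq_single (by simpa using hb.mem ∅) fun c => ?_
      have h1 : (MvPolynomial.X i * (b ∅ c) : MvPolynomial κ k) ∈
          Ideal.span (MvPolynomial.X '' (T : Set κ) : Set (MvPolynomial κ k)) := by
        have h2 : ((MvPolynomial.X i : MvPolynomial κ k) • b) ∅ c = MvPolynomial.X i * b ∅ c := rfl
        rw [← h2, ← hzb, diff_apply, Finset.sum_apply, Finsupp.finsetSum_apply]
        refine Ideal.sum_mem _ fun j hj => ?_
        exact Ideal.mul_mem_right _ _ (Ideal.subset_span ⟨j, hj, rfl⟩)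
      rw [MvPolynomial.mem_ideal_span_X_image] at h1 ⊢
      intro m hm
      obtain ⟨j, hj, hmj⟩ := h1 (Finsupp.single i 1 + m) (by
        rwa [MvPolynomial.mem_support_iff, MvPolynomial.coeff_X_mul, ← MvPolynomial.mem_support_iff])
      refine ⟨j, hj, fun h0 => hmj ?_⟩
      have : i ≠ j := fun h => hi (h ▸ hj)
      simp [h0, this]
    · exact fun b _ hb hb0 _ _ => ih q _ b hb hb0

end Free

end Koszul

/-! ### Minimal resolutions and Koszul homology -/

namespace MinimalFreeResolution

variable {k : Type*} [Field k] {κ A : Type*} [AddCommGroup A] {w : κ → A}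
  {M : Type*} [AddCommGroup M] [Module (MvPolynomial κ k) M] {ℳ : A → AddSubgroup M}
  (F : MinimalFreeResolution (k := k) w ℳ)

theorem apply_mem_of_mem_smul_top {R gen : Type*} [CommRing R] {J : Ideal R} {f : gen →₀ R}
    (hf : f ∈ J • (⊤ : Submodule R (gen →₀ R))) (b : gen) : f b ∈ J := by
  induction hf using Submodule.smul_induction_on' with
  | smul r hr g _ => exact J.mul_mem_right _ hr
  | add f _ g _ hf hg => exact J.add_mem hf hg

theorem diff_mem_freeGrading (j : ℕ) {a : A} {f : F.gen (j + 1) →₀ MvPolynomial κ k}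
    (hf : f ∈ Koszul.freeGrading w (F.deg (j + 1)) a) :
    F.diff j f ∈ Koszul.freeGrading w (F.deg j) a := by
  intro c
  rw [← Finsupp.sum_single f, Finsupp.sum, map_sum, Finsupp.finsetSum_apply]
  refine Submodule.sum_mem (MvPolynomial.weightedHomogeneousSubmodule k w _) fun b _ => ?_
  rw [← mul_one (f b), ← smul_eq_mul, ← Finsupp.smul_single, map_smul, Finsupp.smul_apply,
    smul_eq_mul]
  have := (hf b).mul (F.diff_homogeneous j b c)
  rwa [sub_add_sub_cancel] at this

theorem aug_mem [DecidableEq A]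
    [SetLike.GradedSMul (MvPolynomial.weightedHomogeneousSubmodule k w) ℳ] {a : A}
    {f : F.gen 0 →₀ MvPolynomial κ k} (hf : f ∈ Koszul.freeGrading w (F.deg 0) a) :
    F.aug f ∈ ℳ a := by
  rw [← Finsupp.sum_single f, Finsupp.sum, map_sum]
  refine AddSubgroup.sum_mem _ fun b _ => ?_
  rw [← mul_one (f b), ← smul_eq_mul, ← Finsupp.smul_single, map_smul]
  have := SetLike.GradedSMul.smul_mem (A := MvPolynomial.weightedHomogeneousSubmodule k w)
    (B := ℳ) (hf b) (F.aug_homogeneous b)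
  rwa [vadd_eq_add, sub_add_cancel] at this

variable [LinearOrder κ] [Fintype κ]

theorem exists_map_diff_eq {i : ℕ} {y : Finset κ → F.gen i →₀ MvPolynomial κ k}
    (h : ∀ J, y J ∈ LinearMap.range (F.diff i)) : ∃ s, Koszul.map (F.diff i) s = y := by
  choose s hs using h
  exact ⟨s, funext hs⟩

/-- The last corner of the zigzag, where $F_0$ meets $M$: a bounding chain over $M$ is lifted along
the augmentation, and the error lies in its kernel, the image of $F_1$. -/
theorem exists_eq_diff_add_map_zero [DecidableEq A]
    [SetLike.GradedSMul (MvPolynomial.weightedHomogeneousSubmodule k w) ℳ] (q : ℕ) (a : A)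
    (y : Finset κ → F.gen 0 →₀ MvPolynomial κ k)
    (hy : Koszul.IsHomog w (Koszul.freeGrading w (F.deg 0)) Finset.univ q a y)
    (hdy : Koszul.diff (MvPolynomial.X : κ → MvPolynomial κ k) Finset.univ
      (Koszul.map F.aug y) = 0)
    (h : ∀ y, Koszul.IsHomog w ℳ Finset.univ q a y →
      Koszul.diff (MvPolynomial.X : κ → MvPolynomial κ k) Finset.univ y = 0 →
        ∃ t, Koszul.diff (MvPolynomial.X : κ → MvPolynomial κ k) Finset.univ t = y) :
    ∃ t s, y = Koszul.diff (MvPolynomial.X : κ → MvPolynomial κ k) Finset.univ t +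
      Koszul.map (F.diff 0) s := by
  have hm : Koszul.IsHomog w ℳ Finset.univ q a (Koszul.map F.aug y) :=
    add_zero a ▸ hy.map fun e m hm => (add_zero e).symm ▸ F.aug_mem hm
  obtain ⟨t, hty⟩ := h _ hm hdy
  choose t' ht' using fun J => F.aug_surjective (t J)
  have ht'' : Koszul.map F.aug t' = t := funext ht'
  rw [← ht'', ← Koszul.map_diff, ← sub_eq_zero, ← map_sub] at hty
  obtain ⟨r, hr⟩ := F.exists_map_diff_eq (i := 0)
    (y := Koszul.diff (MvPolynomial.X : κ → MvPolynomial κ k) Finset.univ t' - y) fun J =>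
      (F.exact_zero _).1 (congrFun hty J)
  exact ⟨t', -r, by rw [map_neg, hr]; abel⟩

/-- A zigzag through the double complex `F ⊗ K`, where `K` is the Koszul complex of the variables. -/
theorem exists_eq_diff_add_map [DecidableEq A]
    [SetLike.GradedSMul (MvPolynomial.weightedHomogeneousSubmodule k w) ℳ] (i q : ℕ) (a : A)
    (y : Finset κ → F.gen (i + 1) →₀ MvPolynomial κ k)
    (hy : Koszul.IsHomog w (Koszul.freeGrading w (F.deg (i + 1))) Finset.univ q a y)
    (hdy : Koszul.diff (MvPolynomial.X : κ → MvPolynomial κ k) Finset.univ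
      (Koszul.map (F.diff i) y) = 0)
    (h : ∀ y, Koszul.IsHomog w ℳ Finset.univ (q + (i + 1)) a y →
      Koszul.diff (MvPolynomial.X : κ → MvPolynomial κ k) Finset.univ y = 0 →
        ∃ t, Koszul.diff (MvPolynomial.X : κ → MvPolynomial κ k) Finset.univ t = y) :
    ∃ t s, y = Koszul.diff (MvPolynomial.X : κ → MvPolynomial κ k) Finset.univ t +
      Koszul.map (F.diff (i + 1)) s := by
  induction i using Nat.strong_induction_on generalizing q with | _ i ih
  have hz : Koszul.IsHomog w (Koszul.freeGrading w (F.deg i)) Finset.univ q a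
      (Koszul.map (F.diff i) y) :=
    add_zero a ▸ hy.map fun e m hm => (add_zero e).symm ▸ F.diff_mem_freeGrading i hm
  obtain ⟨y', hy', hyy'⟩ : ∃ y', Koszul.IsHomog w (Koszul.freeGrading w (F.deg i)) Finset.univ
      (q + 1) a y' ∧ Koszul.diff (MvPolynomial.X : κ → MvPolynomial κ k) Finset.univ y' =
        Koszul.map (F.diff i) y := by
    -- Acyclicity of free modules fails in homological degree $0$, where $H_0=F_i/\mathfrak mF_i$;
    -- there minimality of the resolution takes its place.
    rcases q with _ | q
    · rw [hz.eq_single_empty]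
      refine Koszul.exists_diff_eq_single (by simpa using hz.mem ∅) fun b => ?_
      rw [Finset.coe_univ, Set.image_univ]
      exact apply_mem_of_mem_smul_top (F.minimal i ⟨y ∅, rfl⟩) b
    · exact Koszul.acyclic_free _ q a _ hz hdy
  suffices ∃ t s, y' = Koszul.diff (MvPolynomial.X : κ → MvPolynomial κ k) Finset.univ t +
      Koszul.map (F.diff i) s by
    obtain ⟨t, s, rfl⟩ := this
    -- Applying the Koszul differential to $y'=dt+\partial s$ gives $\partial y=\partial(ds)$, so
    -- $y-ds$ comes from the next term of the resolution.
    rw [map_add, Koszul.diff_diff, zero_add, ← Koszul.map_diff, ← sub_eq_zero, ← map_sub] at hyy'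
    obtain ⟨r, hr⟩ := F.exists_map_diff_eq (i := i + 1)
      (y := Koszul.diff (MvPolynomial.X : κ → MvPolynomial κ k) Finset.univ s - y) fun J =>
        (F.exact_succ i _).1 (congrFun hyy' J)
    exact ⟨s, -r, by rw [map_neg, hr]; abel⟩
  rcases i with _ | i
  · refine F.exists_eq_diff_add_map_zero (q + 1) a y' hy' ?_ h
    rw [← Koszul.map_diff, hyy']
    ext1 J
    exact F.exact_zero.apply_apply_eq_zero _
  · refine ih i i.lt_succ_self (q + 1) y' hy' ?_ (by
      rwa [show q + 1 + (i + 1) = q + (i + 1 + 1) by omega])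
    rw [← Koszul.map_diff, hyy']
    ext1 J
    exact (F.exact_succ i).apply_apply_eq_zero _

/-- The generators of a minimal free resolution have no degrees in which the Koszul homology of the
module vanishes. -/
theorem not_koszul_exact [DecidableEq A]
    [SetLike.GradedSMul (MvPolynomial.weightedHomogeneousSubmodule k w) ℳ] (j : ℕ) (ε : F.gen j) :
    ¬ ∀ y, Koszul.IsHomog w ℳ Finset.univ j (F.deg j ε) y →
      Koszul.diff (MvPolynomial.X : κ → MvPolynomial κ k) Finset.univ y = 0 →
        ∃ t, Koszul.diff (MvPolynomial.X : κ → MvPolynomial κ k) Finset.univ t = y := by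
  intro h
  have he : Finsupp.single ε (1 : MvPolynomial κ k) ∈ Koszul.freeGrading w (F.deg j) (F.deg j ε) := by
    intro c
    by_cases hc : ε = c
    · subst hc
      rw [Finsupp.single_eq_same, sub_self]
      exact MvPolynomial.isWeightedHomogeneous_one k w
    · rw [Finsupp.single_eq_of_ne' hc]
      exact MvPolynomial.isWeightedHomogeneous_zero k w _
  have hy := Koszul.isHomog_single_empty (w := w) (T := Finset.univ) he
  obtain ⟨t, s, hts⟩ : ∃ t s,
      (Pi.single ∅ (Finsupp.single ε 1) : Finset κ → F.gen j →₀ MvPolynomial κ k) =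
      Koszul.diff (MvPolynomial.X : κ → MvPolynomial κ k) Finset.univ t +
        Koszul.map (F.diff j) s := by
    rcases j with _ | j
    · refine F.exists_eq_diff_add_map_zero 0 _ _ hy ?_ h
      rw [← Koszul.map_diff, hy.diff_zero, map_zero]
    · refine F.exists_eq_diff_add_map j 0 _ _ hy ?_ (by rwa [zero_add])
      rw [← Koszul.map_diff, hy.diff_zero, map_zero]
  have h1 := congrArg (fun f => f ε) (congrFun hts ∅)
  simp only [Pi.single_eq_same, Finsupp.single_eq_same, Pi.add_apply, Finsupp.add_apply,
    Koszul.diff_apply, Finset.sum_apply, Finsupp.finsetSum_apply] at h1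
  -- Koszul boundaries have coefficients in $\mathfrak m$, and so do images of the differential by
  -- minimality; the $\varepsilon$-coordinate would give $1\in\mathfrak m$.
  have h2 : (1 : MvPolynomial κ k) ∈
      Ideal.span (Set.range (MvPolynomial.X : κ → MvPolynomial κ k)) := by
    rw [h1]
    refine Ideal.add_mem _ (Ideal.sum_mem _ fun i _ => ?_)
      (apply_mem_of_mem_smul_top (F.minimal j ⟨s ∅, rfl⟩) ε)
    exact Ideal.mul_mem_right _ _ (Ideal.subset_span ⟨i, rfl⟩)
  rw [← Set.image_univ, MvPolynomial.mem_ideal_span_X_image] at h2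
  obtain ⟨i, _, hi⟩ := h2 0 (by simp)
  exact hi rfl

end MinimalFreeResolution

/-! ### Signs of the coefficients of a primitive relation -/

namespace SimplicialFan

variable {N : Type*} [AddCommGroup N] {n : ℕ} {Δ : SimplicialFan N n}

theorem degI_varDegree (hΔ : Δ.IsComplete) (I : Finset (Fin (n + 1))) (i : Fin (n + 1)) :
    degI hΔ I (Δ.varDegree i) = intCoeff hΔ I i := by
  rw [varDegree, degI]
  erw [QuotientAddGroup.lift_mk]
  simp [AddMonoidHom.finsetSum_apply, Pi.single_apply]

theorem coeff_nonneg (hΔ : Δ.IsComplete) (v : ℚ ⊗[ℤ] N) (i : Fin (n + 1)) : 0 ≤ coeff hΔ v i :=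
  (hΔ.exists_coeff v).choose_spec.1 i

theorem coeff_support_mem (hΔ : Δ.IsComplete) (v : ℚ ⊗[ℤ] N) :
    Finset.univ.filter (fun i => coeff hΔ v i ≠ 0) ∈ Δ.cones :=
  (hΔ.exists_coeff v).choose_spec.2.1

theorem sum_coeff (hΔ : Δ.IsComplete) (v : ℚ ⊗[ℤ] N) : v = ∑ i, coeff hΔ v i • Δ.rayQ i :=
  (hΔ.exists_coeff v).choose_spec.2.2

theorem mem_cone_iff {σ : Finset (Fin (n + 1))} {v : ℚ ⊗[ℤ] N} :
    v ∈ Δ.cone σ ↔ ∃ c : Fin (n + 1) → ℚ, (∀ i, 0 ≤ c i) ∧ (∀ i ∉ σ, c i = 0) ∧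
      v = ∑ i, c i • Δ.rayQ i := by
  unfold cone PointedCone.hull
  constructor
  · rw [Submodule.mem_span_image_finset_iff_exists_fun]
    rintro ⟨c, rfl⟩
    refine ⟨fun i => if h : i ∈ σ then (c ⟨i, h⟩ : ℚ) else 0, fun i => ?_,
      fun i h => dif_neg h, ?_⟩
    · by_cases h : i ∈ σ
      · simpa [h] using (c ⟨i, h⟩).2
      · simp [h]
    · rw [← Finset.sum_subset (Finset.subset_univ σ) (by intro i _ h; simp [h]),
        ← Finset.sum_coe_sort σ]
      exact Finset.sum_congr rfl fun i _ => by simp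
  · rintro ⟨c, hc, hc0, rfl⟩
    refine Submodule.sum_mem _ fun i _ => ?_
    by_cases h : i ∈ σ
    · exact Submodule.smul_mem _ (⟨c i, hc i⟩ : {c : ℚ // 0 ≤ c})
        (Submodule.subset_span ⟨i, h, rfl⟩)
    · rw [hc0 i h, zero_smul]; exact Submodule.zero_mem _

theorem coeff_ext {σ : Finset (Fin (n + 1))} (hσ : σ ∈ Δ.cones) {c d : Fin (n + 1) → ℚ}
    (hc : ∀ i ∉ σ, c i = 0) (hd : ∀ i ∉ σ, d i = 0)
    (h : ∑ i, c i • Δ.rayQ i = ∑ i, d i • Δ.rayQ i) : c = d := by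
  have hli := Δ.linearIndepOn σ hσ
  rw [linearIndepOn_finset_iff] at hli
  have h0 : ∑ i ∈ σ, (c i - d i) • ((1 : ℚ) ⊗ₜ[ℤ] Δ.ray i) = 0 := by
    rw [Finset.sum_subset (Finset.subset_univ σ) (by
      intro i _ hi; rw [hc i hi, hd i hi, sub_zero, zero_smul])]
    simp only [sub_smul, Finset.sum_sub_distrib]
    exact sub_eq_zero.2 h
  ext i
  by_cases hi : i ∈ σ
  · exact sub_eq_zero.1 (hli _ h0 i hi)
  · rw [hc i hi, hd i hi]

/-- A vector lies in the relative interior of only one cone of the fan. -/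
theorem support_subset_of_sum_eq {c d : Fin (n + 1) → ℚ} (hc : ∀ i, 0 ≤ c i) (hd : ∀ i, 0 ≤ d i)
    (hcΔ : Finset.univ.filter (fun i => c i ≠ 0) ∈ Δ.cones)
    (hdΔ : Finset.univ.filter (fun i => d i ≠ 0) ∈ Δ.cones)
    (h : ∑ i, c i • Δ.rayQ i = ∑ i, d i • Δ.rayQ i) {i : Fin (n + 1)} (hi : c i ≠ 0) : d i ≠ 0 := by
  have h1 : ∑ i, c i • Δ.rayQ i ∈ Δ.cone (Finset.univ.filter (fun i => c i ≠ 0)) ⊓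
      Δ.cone (Finset.univ.filter (fun i => d i ≠ 0)) :=
    ⟨mem_cone_iff.2 ⟨c, hc, by simp, rfl⟩, mem_cone_iff.2 ⟨d, hd, by simp, h⟩⟩
  -- The vector lies in the common face of both cones; uniqueness of coefficients in the first cone
  -- makes $c$ vanish outside that face.
  have h2 : ∑ i, c i • Δ.rayQ i ∈ Δ.cone
      (Finset.univ.filter (fun i => c i ≠ 0) ∩ Finset.univ.filter (fun i => d i ≠ 0)) := by
    rw [cone, ← show _ = PointedCone.hull ℚ (Δ.rayQ '' _) from Δ.inter _ hcΔ _ hdΔ]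
    exact h1
  obtain ⟨e, -, he, hce⟩ := mem_cone_iff.1 h2
  have hce' : c = e := coeff_ext hcΔ (by simp) (fun j hj => he j fun hj' =>
    hj (Finset.mem_of_mem_inter_left hj')) hce
  intro hdi
  exact hi (hce' ▸ he i (by simp [hdi]))

/-- If $c_i\ge1$, subtracting $u_i$ writes $\sum_{I\setminus i}u_j$ as a nonnegative combination
both of the rays in $I\setminus i$ and of rays of $\gamma$. Both supports span cones, so they agree;
hence $I\subseteq\gamma(1)$, which is impossible for a primitive collection. -/
theorem IsPrimitiveCollection.coeff_lt_one (hΔ : Δ.IsComplete) {I : Finset (Fin (n + 1))}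
    (hI : Δ.IsPrimitiveCollection I) {i : Fin (n + 1)} (hi : i ∈ I) :
    coeff hΔ (∑ i ∈ I, Δ.rayQ i) i < 1 := by
  by_contra! hle
  set c := coeff hΔ (∑ i ∈ I, Δ.rayQ i) with hc
  have hcΔ := coeff_support_mem hΔ (∑ i ∈ I, Δ.rayQ i)
  rw [← hc] at hcΔ
  let d : Fin (n + 1) → ℚ := fun j => c j - if j = i then 1 else 0
  let e : Fin (n + 1) → ℚ := fun j => if j ∈ I.erase i then 1 else 0
  have hd : ∀ j, 0 ≤ d j := fun j => by
    by_cases h : j = i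
    · subst h; simpa [d] using hle
    · simpa [d, h] using coeff_nonneg hΔ _ j
  have he : ∀ j, 0 ≤ e j := fun j => by simp only [e]; split_ifs <;> norm_num
  have hdΔ : Finset.univ.filter (fun i => d i ≠ 0) ∈ Δ.cones := by
    refine Δ.mem_of_subset _ hcΔ _ fun j hj => ?_
    simp only [Finset.mem_filter, Finset.mem_univ, true_and, d] at hj ⊢
    intro h
    by_cases hji : j = i
    · subst hji; rw [h] at hle; norm_num at hle
    · simp [hji, h] at hj
  have heΔ : Finset.univ.filter (fun i => e i ≠ 0) ∈ Δ.cones := by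
    obtain ⟨σ, hσ, hIσ⟩ := hI.2 (I.erase i) (Finset.erase_ssubset hi)
    refine Δ.mem_of_subset _ hσ _ fun j hj => hIσ ?_
    by_contra h
    exact h (by simpa [e] using hj)
  have hsum : ∑ j, d j • Δ.rayQ j = ∑ j, e j • Δ.rayQ j := by
    have h1 : ∑ j, d j • Δ.rayQ j = ∑ j ∈ I, Δ.rayQ j - Δ.rayQ i := by
      simp only [d, sub_smul, Finset.sum_sub_distrib, ite_smul, one_smul, zero_smul,
        Finset.sum_ite_eq', Finset.mem_univ, if_true]
      rw [hc, ← sum_coeff]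
    rw [h1, ← Finset.sum_erase_eq_sub hi]
    simp only [e, ite_smul, one_smul, zero_smul, Finset.sum_ite_mem, Finset.univ_inter]
  refine hI.1 _ hcΔ fun j hj => ?_
  simp only [Finset.mem_filter, Finset.mem_univ, true_and]
  by_cases hji : j = i
  · subst hji; intro h; rw [h] at hle; norm_num at hle
  · have := support_subset_of_sum_eq he hd heΔ hdΔ hsum.symm (i := j) (by simp [e, hji, hj])
    simpa [d, hji] using this

theorem relationDen_pos (hΔ : Δ.IsComplete) (I : Finset (Fin (n + 1))) : 0 < relationDen hΔ I := by
  rw [Nat.pos_iff_ne_zero, relationDen, Ne, Finset.lcm_eq_zero_iff]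
  simp

theorem IsPrimitiveCollection.intCoeff_pos (hΔ : Δ.IsComplete) {I : Finset (Fin (n + 1))}
    (hI : Δ.IsPrimitiveCollection I) {i : Fin (n + 1)} (hi : i ∈ I) : 0 < intCoeff hΔ I i := by
  have h : (0 : ℚ) < intCoeff hΔ I i := by
    rw [intCoeff_cast]
    refine mul_pos (by exact_mod_cast relationDen_pos hΔ I) ?_
    rw [relationCoeff, if_pos hi, sub_pos]
    exact hI.coeff_lt_one hΔ hi
  exact_mod_cast h

theorem intCoeff_nonpos (hΔ : Δ.IsComplete) {I : Finset (Fin (n + 1))} {i : Fin (n + 1)}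
    (hi : i ∉ I) : intCoeff hΔ I i ≤ 0 := by
  have h : (intCoeff hΔ I i : ℚ) ≤ 0 := by
    rw [intCoeff_cast]
    refine mul_nonpos_of_nonneg_of_nonpos (by positivity) ?_
    rw [relationCoeff, if_neg hi, zero_sub, neg_nonpos]
    exact coeff_nonneg hΔ _ i
  exact_mod_cast h

end SimplicialFan

/-! ### The graded Čech complex -/

namespace WeightedReg

variable {k : Type*} [Field k] {ι : Type*} {M : Type*} [AddCommGroup M] [Module (MvPolynomial ι k) M]

theorem monomials_mono {U T : Finset ι} (h : U ⊆ T) : monomials k U ≤ monomials k T :=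
  Submonoid.closure_mono (Set.image_mono (by exact_mod_cast h))

/-- The localization map `M[x_i⁻¹ : i ∈ U] → M[x_i⁻¹ : i ∈ T]` for `U ⊆ T`. -/
def res {U T : Finset ι} (h : U ⊆ T) : Loc k M U →ₗ[MvPolynomial ι k] Loc k M T :=
  LocalizedModule.liftOfLE (monomials k U) (monomials k T) (monomials_mono h)

theorem res_mk {U T : Finset ι} (h : U ⊆ T) (m : M) (s : monomials k U) :
    res h (LocalizedModule.mk m s : LocalizedModule (monomials k U) M) =
      LocalizedModule.mk m (⟨s, monomials_mono h s.2⟩ : monomials k T) := by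
  rw [res, LocalizedModule.liftOfLE, IsLocalizedModule.mk_eq_mk', IsLocalizedModule.liftOfLE_mk',
    IsLocalizedModule.mk_eq_mk']

theorem res_res {U V T : Finset ι} (h : U ⊆ V) (h' : V ⊆ T) (c : Loc k M U) :
    res h' (res h c) = res (h.trans h') c := by
  induction c using LocalizedModule.induction_on with | h m s
  rw [res_mk, res_mk, res_mk]

theorem res_congr (c : (T : Finset ι) → Loc k M T) {U V T : Finset ι} (h : U = V) (hU : U ⊆ T)
    (hV : V ⊆ T) : res hU (c U) = res hV (c V) := by
  subst h; rfl

section CechDiff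

variable [LinearOrder ι]

theorem cechDiff_apply (c : (T : Finset ι) → Loc k M T) (T : Finset ι) :
    cechDiff k M c T = ∑ i ∈ T, Koszul.sgn i T • res (Finset.erase_subset i T) (c (T.erase i)) := by
  simp only [cechDiff, LinearMap.pi_apply, LinearMap.sum_apply]
  rfl

theorem sgn_erase_anticomm {i j : ι} {T : Finset ι} (hi : i ∈ T) (hj : j ∈ T) (hij : i ≠ j) :
    Koszul.sgn i T * Koszul.sgn j (T.erase i) = -(Koszul.sgn j T * Koszul.sgn i (T.erase j)) := by
  obtain ⟨K, hiK, hjK, rfl⟩ : ∃ K, i ∉ K ∧ j ∉ K ∧ insert i (insert j K) = T := by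
    refine ⟨(T.erase i).erase j, by simp, by simp, ?_⟩
    rw [Finset.insert_erase (by simp [hj, hij.symm]), Finset.insert_erase hi]
  have h1 : (insert i (insert j K)).erase i = insert j K :=
    Finset.erase_insert (by simp [hij, hiK])
  have h2 : (insert i (insert j K)).erase j = insert i K := by
    rw [Finset.insert_comm, Finset.erase_insert (by simp [hij.symm, hjK])]
  rw [← Koszul.sgn_erase_self i (insert i _), ← Koszul.sgn_erase_self j (insert i (insert j K)),
    h1, h2, Koszul.sgn_insert_self, Koszul.sgn_insert_self,
    mul_comm, mul_comm (Koszul.sgn j (insert i K)), Koszul.sgn_anticomm hij hiK hjK, neg_neg]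

theorem cechDiff_cechDiff (c : (T : Finset ι) → Loc k M T) : cechDiff k M (cechDiff k M c) = 0 := by
  ext T
  let f : ι → ι → Loc k M T := fun i j => if j = i then 0 else
    (Koszul.sgn i T * Koszul.sgn j (T.erase i)) •
      res (((T.erase i).erase_subset j).trans (T.erase_subset i)) (c ((T.erase i).erase j))
  have h : cechDiff k M (cechDiff k M c) T = ∑ i ∈ T, ∑ j ∈ T, f i j := by
    rw [cechDiff_apply]
    refine Finset.sum_congr rfl fun i hi => ?_
    rw [cechDiff_apply, map_sum, ← Finset.sum_zsmul, ← Finset.add_sum_erase T (f i) hi]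
    simp only [f, if_true, zero_add]
    refine Finset.sum_congr rfl fun j hj => ?_
    rw [if_neg (Finset.ne_of_mem_erase hj), map_zsmul, res_res, smul_smul]
  rw [h, Pi.zero_apply]
  refine Koszul.sum_sum_eq_zero_of_antisymm T f (fun i _ => if_pos rfl) fun i hi j hj => ?_
  rcases eq_or_ne i j with rfl | hij
  · simp [f]
  · simp only [f, if_neg hij, if_neg hij.symm]
    rw [sgn_erase_anticomm hi hj hij, res_congr c Finset.erase_right_comm _
        (((T.erase j).erase_subset i).trans (T.erase_subset j)), neg_smul,
      neg_add_cancel]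

end CechDiff

/-! ### Degrees -/

variable (d : ι → ℤ) (𝓜 : ℤ → AddSubgroup M)

variable {d 𝓜}

theorem map_locDegree {U T : Finset ι} {e e' : ℤ} (f : Loc k M U →+ Loc k M T)
    (h : ∀ (s : monomials k U) (a : ℤ) (m : M),
      MvPolynomial.IsWeightedHomogeneous d (s : MvPolynomial ι k) a → m ∈ 𝓜 (e + a) →
        f (LocalizedModule.mk m s) ∈ locDegree k d 𝓜 T e')
    {c : Loc k M U} (hc : c ∈ locDegree k d 𝓜 U e) : f c ∈ locDegree k d 𝓜 T e' := by
  have : locDegree k d 𝓜 U e ≤ (locDegree k d 𝓜 T e').comap f := by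
    rw [locDegree, AddSubgroup.closure_le]
    rintro _ ⟨s, a, m, hs, hm, rfl⟩
    exact h s a m hs hm
  exact this hc

theorem mk_mem_locDegree {T : Finset ι} {e a : ℤ} {s : monomials k T} {m : M}
    (hs : MvPolynomial.IsWeightedHomogeneous d (s : MvPolynomial ι k) a) (hm : m ∈ 𝓜 (e + a)) :
    LocalizedModule.mk m s ∈ locDegree k d 𝓜 T e :=
  AddSubgroup.subset_closure ⟨s, a, m, hs, hm, rfl⟩

theorem res_mem_locDegree {U T : Finset ι} (h : U ⊆ T) {e : ℤ} {c : Loc k M U}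
    (hc : c ∈ locDegree k d 𝓜 U e) : res h c ∈ locDegree k d 𝓜 T e := by
  refine map_locDegree (res h).toAddMonoidHom (fun s a m hs hm => ?_) hc
  rw [LinearMap.toAddMonoidHom_coe, res_mk]
  refine mk_mem_locDegree (a := a) ?_ hm
  exact hs

theorem X_smul_mem_locDegree (h𝓜 : ∀ i e, ∀ m ∈ 𝓜 e, (MvPolynomial.X i : MvPolynomial ι k) • m ∈
    𝓜 (e + d i)) {T : Finset ι} (i : ι) {e : ℤ} {c : Loc k M T} (hc : c ∈ locDegree k d 𝓜 T e) :
    (MvPolynomial.X i : MvPolynomial ι k) • c ∈ locDegree k d 𝓜 T (e + d i) := by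
  refine map_locDegree (DistribSMul.toAddMonoidHom _ (MvPolynomial.X i : MvPolynomial ι k))
    (fun s a m hs hm => ?_) hc
  rw [DistribSMul.toAddMonoidHom_apply, LocalizedModule.smul'_mk]
  exact mk_mem_locDegree hs (add_right_comm e a (d i) ▸ h𝓜 i _ m hm)

/-- Division by the variable `x_i`. -/
def divX {T : Finset ι} {i : ι} (hi : i ∈ T) : Loc k M T →ₗ[MvPolynomial ι k] Loc k M T :=
  LocalizedModule.divBy (⟨MvPolynomial.X i, Submonoid.subset_closure ⟨i, hi, rfl⟩⟩ : monomials k T)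

theorem X_smul_divX {T : Finset ι} {i : ι} (hi : i ∈ T) (c : Loc k M T) :
    (MvPolynomial.X i : MvPolynomial ι k) • divX hi c = c := by
  have := LocalizedModule.mul_by_divBy
    (⟨MvPolynomial.X i, Submonoid.subset_closure ⟨i, hi, rfl⟩⟩ : monomials k T) c
  rwa [Module.algebraMap_end_apply] at this

theorem divX_mem_locDegree {T : Finset ι} {i : ι} (hi : i ∈ T) {e : ℤ} {c : Loc k M T}
    (hc : c ∈ locDegree k d 𝓜 T e) : divX hi c ∈ locDegree k d 𝓜 T (e - d i) := by
  refine map_locDegree (divX hi).toAddMonoidHom (fun s a m hs hm => ?_) hc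
  rw [LinearMap.toAddMonoidHom_coe, divX, LocalizedModule.divBy_apply, LocalizedModule.liftOn_mk]
  refine mk_mem_locDegree (a := a + d i) ?_ ?_
  · exact hs.mul (MvPolynomial.isWeightedHomogeneous_X k d i)
  · rwa [add_comm a, ← add_assoc, sub_add_cancel]

theorem mem_cochains {p e : ℤ} {c : (T : Finset ι) → Loc k M T} :
    c ∈ cochains k d 𝓜 p e ↔
      ∀ T, c T ∈ if (T.card : ℤ) = p then locDegree k d 𝓜 T e else ⊥ := by
  simp [cochains, AddSubgroup.mem_pi]

/-- Stops the Čech–Koszul zigzag at both ends: $p=-1$ and $p>\#\iota$. -/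
theorem cochains_eq_bot {p : ℤ} (hp : ∀ T : Finset ι, (T.card : ℤ) ≠ p) (e : ℤ) :
    cochains k d 𝓜 p e = ⊥ := by
  rw [eq_bot_iff]
  intro c hc
  rw [AddSubgroup.mem_bot]
  ext T
  have := mem_cochains.1 hc T
  rwa [if_neg (hp T)] at this

theorem X_smul_mem_cochains (h𝓜 : ∀ i e, ∀ m ∈ 𝓜 e, (MvPolynomial.X i : MvPolynomial ι k) • m ∈
    𝓜 (e + d i)) (i : ι) {p e : ℤ} {c : (T : Finset ι) → Loc k M T}
    (hc : c ∈ cochains k d 𝓜 p e) :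
    (MvPolynomial.X i : MvPolynomial ι k) • c ∈ cochains k d 𝓜 p (e + d i) := by
  rw [mem_cochains] at hc ⊢
  intro T
  have := hc T
  split_ifs at this ⊢
  · exact X_smul_mem_locDegree h𝓜 i this
  · rw [Pi.smul_apply, AddSubgroup.mem_bot.1 this, smul_zero]; exact zero_mem _

theorem cechDiff_mem_cochains [LinearOrder ι] {p e : ℤ} {c : (T : Finset ι) → Loc k M T}
    (hc : c ∈ cochains k d 𝓜 p e) : cechDiff k M c ∈ cochains k d 𝓜 (p + 1) e := by
  rw [mem_cochains] at hc ⊢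
  intro T
  rw [cechDiff_apply]
  refine AddSubgroup.sum_mem _ fun i hi => AddSubgroup.zsmul_mem _ ?_ _
  have := hc (T.erase i)
  have hcard : ((T.erase i).card : ℤ) = T.card - 1 := by
    rw [Finset.card_erase_of_mem hi, Nat.cast_sub (Finset.card_pos.2 ⟨i, hi⟩), Nat.cast_one]
  rw [hcard] at this
  by_cases h : (T.card : ℤ) = p + 1
  · rw [if_pos h]
    rw [if_pos (by omega)] at this
    exact res_mem_locDegree _ this
  · rw [if_neg h]
    rw [if_neg (by omega)] at this
    rw [AddSubgroup.mem_bot.1 this, map_zero]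
    exact zero_mem _

theorem exists_cechDiff_eq [LinearOrder ι] {p e : ℤ}
    (h : Subsingleton (LocalCohomology k d 𝓜 p e)) {c : (T : Finset ι) → Loc k M T}
    (hc : c ∈ cochains k d 𝓜 p e) (hc0 : cechDiff k M c = 0) :
    ∃ b ∈ cochains k d 𝓜 (p - 1) e, cechDiff k M b = c := by
  rw [QuotientAddGroup.subsingleton_iff] at h
  have : (⟨c, hc, hc0⟩ : cocycles k d 𝓜 p e) ∈
      (coboundaries k d 𝓜 p e).addSubgroupOf (cocycles k d 𝓜 p e) := h ▸ AddSubgroup.mem_top _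
  exact this

/-! ### Cochains of degree zero -/

/-- `M` is the term of degree `0` of the Čech complex. -/
def toCech : M →ₗ[MvPolynomial ι k] ((T : Finset ι) → Loc k M T) := by
  classical
  exact (LinearMap.single (MvPolynomial ι k) (fun T => Loc k M T) ∅).comp
    (LocalizedModule.mkLinearMap (monomials k ∅) M)

theorem monomials_empty : monomials k (∅ : Finset ι) = ⊥ := by
  simp [monomials]

theorem toCech_injective : Function.Injective (toCech (k := k) (ι := ι) (M := M)) := by
  classical
  intro m m' h
  have h1 : LocalizedModule.mk m (1 : monomials k (∅ : Finset ι)) = LocalizedModule.mk m' 1 := by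
    simpa [toCech] using congrFun h ∅
  obtain ⟨⟨u, hu⟩, h2⟩ := LocalizedModule.mk_eq.1 h1
  rw [monomials_empty, Submonoid.mem_bot] at hu
  subst hu
  simpa using h2

theorem toCech_mem_cochains {e : ℤ} {m : M} (hm : m ∈ 𝓜 e) :
    toCech m ∈ cochains k d 𝓜 0 e := by
  classical
  rw [mem_cochains]
  intro T
  by_cases h : T = ∅
  · subst h
    rw [if_pos (by simp)]
    simp only [toCech, LinearMap.comp_apply, LinearMap.single_apply, Pi.single_eq_same]
    refine mk_mem_locDegree (a := 0) (MvPolynomial.isWeightedHomogeneous_one k d) (by simpa)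
  · rw [if_neg (by simpa using h)]
    simp only [toCech, LinearMap.comp_apply, LinearMap.single_apply, Pi.single_eq_of_ne h]
    exact zero_mem _

theorem exists_toCech_eq {e : ℤ} {c : (T : Finset ι) → Loc k M T} (hc : c ∈ cochains k d 𝓜 0 e) :
    ∃ m ∈ 𝓜 e, toCech m = c := by
  classical
  rw [mem_cochains] at hc
  have h1 : locDegree k d 𝓜 ∅ e ≤
      (𝓜 e).map (LocalizedModule.mkLinearMap (monomials k ∅) M).toAddMonoidHom := by
    rw [locDegree, AddSubgroup.closure_le]
    rintro _ ⟨⟨s, hs'⟩, a, m, hs, hm, rfl⟩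
    rw [monomials_empty, Submonoid.mem_bot] at hs'
    subst hs'
    have : a = 0 := hs.inj_right one_ne_zero (MvPolynomial.isWeightedHomogeneous_one k d)
    subst this
    exact ⟨m, by simpa using hm, rfl⟩
  have h2 := hc ∅
  rw [if_pos (by simp)] at h2
  obtain ⟨m, hm, hmc⟩ := h1 h2
  refine ⟨m, hm, ?_⟩
  ext T
  by_cases h : T = ∅
  · subst h
    simpa [toCech] using hmc
  · have h3 := hc T
    rw [if_neg (by simpa using h), AddSubgroup.mem_bot] at h3
    simp [toCech, Pi.single_eq_of_ne h, h3]

end WeightedReg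

/-! ### From local cohomology to Koszul homology -/

namespace WeightedReg

variable {k : Type*} [Field k] {ι : Type*} {M : Type*} [AddCommGroup M] [Module (MvPolynomial ι k) M]
  {d : ι → ℤ} {𝓜 : ℤ → AddSubgroup M} {κ : Type*} [LinearOrder κ] {w : κ → ℤ}
  {x : κ → MvPolynomial ι k} {I : Finset κ}

/-- In positive cohomological degrees, the Koszul complex with coefficients in the Čech complex is
acyclic. -/
theorem acyclic_cochains (hI : ∀ i, ∃ l ∈ I, x l = MvPolynomial.X i ∧ w l = d i)
    (p q : ℕ) (e : ℤ) : Koszul.Acyclic w x (cochains k d 𝓜 (p + 1)) I q e := by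
  intro y hy hdy
  let 𝓖 (T : Finset ι) (e : ℤ) : AddSubgroup (Loc k M T) :=
    if (T.card : ℤ) = p + 1 then locDegree k d 𝓜 T e else ⊥
  have key : ∀ T, ∃ t, Koszul.IsHomog w (𝓖 T) I (q + 1) e t ∧
      Koszul.diff x I t = Koszul.map
        (LinearMap.proj T : _ →ₗ[MvPolynomial ι k] Loc k M T) y := by
    intro T
    have hyT : Koszul.IsHomog w (𝓖 T) I q e (Koszul.map
        (LinearMap.proj T : _ →ₗ[MvPolynomial ι k] Loc k M T) y) :=
      add_zero e ▸ hy.map fun e' c hc => (add_zero e').symm ▸ mem_cochains.1 hc T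
    by_cases hT : (T.card : ℤ) = p + 1
    -- Any $i\in T$ gives a variable that is invertible on this component, hence a contracting
    -- homotopy.
    · obtain ⟨i, hi⟩ : T.Nonempty := Finset.card_pos.1 (by omega)
      obtain ⟨l, hl, hxl, hwl⟩ := hI i
      refine Koszul.acyclic_of_inverse hl (divX hi) ?_ ?_ _ hyT ?_
      · rw [hxl]; exact X_smul_divX hi
      · intro e' c hc
        simp only [𝓖, if_pos hT] at hc ⊢
        rw [hwl]
        exact divX_mem_locDegree hi hc
      · rw [← Koszul.map_diff, hdy, map_zero]
    · refine ⟨0, Koszul.IsHomog.zero, ?_⟩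
      rw [map_zero]
      ext1 J
      have := hyT.mem J
      simp only [𝓖, if_neg hT] at this
      exact (AddSubgroup.mem_bot.1 this).symm
  choose t ht hty using key
  refine ⟨fun J T => t T J, ⟨fun J => mem_cochains.2 fun T => (ht T).mem J, fun J hJ => ?_⟩, ?_⟩
  · obtain ⟨T, hT⟩ := Function.ne_iff.1 hJ
    exact (ht T).supp J hT
  · ext J T
    rw [show y J T = Koszul.map (LinearMap.proj T : _ →ₗ[MvPolynomial ι k] Loc k M T) y J from rfl,
      ← hty T]
    exact congrFun (Koszul.map_diff (LinearMap.proj T : _ →ₗ[MvPolynomial ι k] Loc k M T) x I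
      fun J T => t T J) J

variable [LinearOrder ι] [Fintype ι]

/-- A zigzag through the double complex of the Čech and the Koszul complex. -/
theorem exists_eq_diff_add_cechDiff
    (h𝓜 : ∀ i e, ∀ m ∈ 𝓜 e, (MvPolynomial.X i : MvPolynomial ι k) • m ∈ 𝓜 (e + d i))
    (hI : ∀ i, ∃ l ∈ I, x l = MvPolynomial.X i ∧ w l = d i)
    (hI' : ∀ l ∈ I, ∃ i, x l = MvPolynomial.X i ∧ w l = d i)
    (e : ℤ) (r p q : ℕ) (hr : Fintype.card ι < p + r)
    (h : ∀ s : ℕ, ∀ J ⊆ I, J.card = q + s →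
      Subsingleton (LocalCohomology k d 𝓜 ((p + s : ℕ) : ℤ) (e - ∑ i ∈ J, w i)))
    (y : Finset κ → (T : Finset ι) → Loc k M T)
    (hy : Koszul.IsHomog w (cochains k d 𝓜 p) I q e y)
    (hdy : Koszul.diff x I (Koszul.map (cechDiff k M) y) = 0) :
    ∃ t s, Koszul.IsHomog w (cochains k d 𝓜 p) I (q + 1) e t ∧
      Koszul.IsHomog w (cochains k d 𝓜 (p - 1)) I q e s ∧
      y = Koszul.diff x I t + Koszul.map (cechDiff k M) s := by
  -- Here $r$ bounds the distance to the cohomological degrees beyond the number of variables, where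
  -- there are no cochains.
  induction r generalizing p q y with
  | zero =>
    refine ⟨0, 0, Koszul.IsHomog.zero, Koszul.IsHomog.zero, ?_⟩
    rw [map_zero, map_zero, add_zero]
    ext1 J
    have := hy.mem J
    rwa [cochains_eq_bot, AddSubgroup.mem_bot] at this
    intro T hT
    have := T.card_le_univ
    omega
  | succ r ih =>
    have hz : Koszul.IsHomog w (cochains k d 𝓜 (p + 1)) I q e (Koszul.map (cechDiff k M) y) :=
      add_zero e ▸ hy.map fun e m hm => (add_zero e).symm ▸ cechDiff_mem_cochains hm
    obtain ⟨y', hy', hyy'⟩ := acyclic_cochains hI p q e _ hz hdy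
    obtain ⟨t, s, -, hs, hts⟩ := ih (p + 1) (q + 1) (by omega) (fun s J hJ hJs => by
        have := h (s + 1) J hJ (by omega)
        rwa [show p + (s + 1) = p + 1 + s by omega] at this) y' (by exact_mod_cast hy') (by
      rw [← Koszul.map_diff, hyy']
      ext1 J
      exact cechDiff_cechDiff _)
    rw [Nat.cast_add, Nat.cast_one, add_sub_cancel_right] at hs
    -- From $\delta y=dy'$ and $y'=dt+\delta s$ it follows that $y-ds$ is a Čech cocycle, so
    -- vanishing of local cohomology applies to each of its components.
    rw [hts, map_add, Koszul.diff_diff, zero_add, ← Koszul.map_diff, eq_comm, ← sub_eq_zero,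
      ← map_sub] at hyy'
    have hu : Koszul.IsHomog w (cochains k d 𝓜 p) I q e (y - Koszul.diff x I s) := by
      refine hy.sub (hs.diff fun l hl e' m hm => ?_)
      obtain ⟨i, hi, hi'⟩ := hI' l hl
      rw [hi, hi']
      exact X_smul_mem_cochains h𝓜 i hm
    -- Choosing $b=0$ at vanishing components keeps the family of the $b_J$ supported on subsets of
    -- $I$ with $q$ elements.
    have hv : ∀ J, ∃ b ∈ cochains k d 𝓜 (p - 1) (e - ∑ i ∈ J, w i),
        cechDiff k M b = (y - Koszul.diff x I s) J ∧ ((y - Koszul.diff x I s) J = 0 → b = 0) := by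
      intro J
      by_cases h0 : (y - Koszul.diff x I s) J = 0
      · exact ⟨0, zero_mem _, by rw [h0, map_zero], fun _ => rfl⟩
      · obtain ⟨hJ, hJq⟩ := hu.supp J h0
        obtain ⟨b, hb, hb'⟩ := exists_cechDiff_eq (h 0 J hJ hJq) (hu.mem J) (congrFun hyy' J)
        exact ⟨b, hb, hb', fun h => absurd h h0⟩
    choose b hb hb' hb0 using hv
    refine ⟨s, b, hs, ⟨hb, fun J hJ => hu.supp J fun h => hJ (hb0 J h)⟩, ?_⟩
    rw [show Koszul.map (cechDiff k M) b = y - Koszul.diff x I s from funext hb', add_sub_cancel]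

/-- Vanishing of local cohomology implies vanishing of Koszul homology. -/
theorem acyclic_of_localCohomology
    (h𝓜 : ∀ i e, ∀ m ∈ 𝓜 e, (MvPolynomial.X i : MvPolynomial ι k) • m ∈ 𝓜 (e + d i))
    (hI : ∀ i, ∃ l ∈ I, x l = MvPolynomial.X i ∧ w l = d i)
    (hI' : ∀ l ∈ I, ∃ i, x l = MvPolynomial.X i ∧ w l = d i) (q : ℕ) (e : ℤ)
    (h : ∀ p : ℕ, ∀ J ⊆ I, J.card = q + p →
      Subsingleton (LocalCohomology k d 𝓜 (p : ℤ) (e - ∑ i ∈ J, w i))) :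
    Koszul.Acyclic w x 𝓜 I q e := by
  intro y hy hdy
  have hy' : Koszul.IsHomog w (cochains k d 𝓜 (0 : ℕ)) I q e (Koszul.map toCech y) :=
    add_zero e ▸ hy.map fun e m hm => (add_zero e).symm ▸ toCech_mem_cochains hm
  obtain ⟨t, s, ht, hs, hts⟩ := exists_eq_diff_add_cechDiff h𝓜 hI hI' e (Fintype.card ι + 1) 0 q
    (by omega) (fun p J hJ hJp => by rw [zero_add]; exact h p J hJ hJp) _ hy' (by
      rw [← Koszul.map_diff, ← Koszul.map_diff, hdy, map_zero, map_zero])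
  -- There are no cochains in degree $-1$, so $y$ is a Koszul boundary in Čech degree $0$, which is
  -- $M$ itself.
  have hs0 : s = 0 := by
    ext1 J
    have := hs.mem J
    rwa [cochains_eq_bot (by intro T; omega), AddSubgroup.mem_bot] at this
  rw [hs0, map_zero, add_zero] at hts
  choose t' ht' htt' using fun J => exists_toCech_eq (ht.mem J)
  refine ⟨t', ⟨ht', fun J hJ => ht.supp J fun h0 => hJ (toCech_injective (k := k) (ι := ι) ?_)⟩, ?_⟩
  · rw [htt', h0, map_zero]
  · ext1 J
    refine toCech_injective (k := k) (ι := ι) ?_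
    change Koszul.map toCech _ J = Koszul.map toCech _ J
    rw [Koszul.map_diff, hts, show Koszul.map toCech t' = t from funext htt']

end WeightedReg

/-! ### Numerical estimates for the weights $w^j$ -/

namespace WeightedReg

section TopWeight

variable {ι : Type*} [Fintype ι] {d : ι → ℤ}

theorem topWeight_neg_one : topWeight d (-1) = -1 := by simp [topWeight]

theorem sum_le_topWeight (J : Finset ι) : ∑ i ∈ J, d i ≤ topWeight d J.card := by
  rw [topWeight, if_neg (by omega), dif_pos (by simpa using Finset.card_le_univ J)]
  exact Finset.le_sup' (fun J => ∑ i ∈ J, d i) (by simp [Finset.mem_powersetCard])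

theorem exists_topWeight_eq {j : ℕ} (hj : j ≤ Fintype.card ι) :
    ∃ J : Finset ι, J.card = j ∧ topWeight d j = ∑ i ∈ J, d i := by
  rw [topWeight, if_neg (by omega), dif_pos (by simpa using hj)]
  obtain ⟨J, hJ, h⟩ := Finset.exists_mem_eq_sup' (Finset.powersetCard_nonempty.2
    (show (j : ℤ).toNat ≤ (Finset.univ : Finset ι).card by simpa using hj)) (fun J => ∑ i ∈ J, d i)
  exact ⟨J, by simpa using (Finset.mem_powersetCard.1 hJ).2, h⟩

theorem topWeight_of_card_lt {j : ℕ} (hj : Fintype.card ι < j) :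
    topWeight d j = ∑ i, d i + 1 := by
  rw [topWeight, if_neg (by omega), dif_neg (by simpa using hj)]

/-- A maximizing set can be enlarged by a variable of positive degree; at $j=\#\iota$ the strictness
is the convention $w^{\#\iota+1}=w^{\#\iota}+1$. -/
theorem topWeight_lt_succ (hd : ∀ i, 0 < d i) {j : ℕ} (hj : j ≤ Fintype.card ι) :
    topWeight d j < topWeight d ((j : ℤ) + 1) := by
  classical
  obtain ⟨J, hJ, h⟩ := exists_topWeight_eq (d := d) hj
  rw [h, ← Nat.cast_succ]
  rcases hj.eq_or_lt with hj' | hj'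
  · rw [topWeight_of_card_lt (by omega), (Finset.card_eq_iff_eq_univ J).1 (by omega)]
    omega
  · obtain ⟨i, hi⟩ : ∃ i, i ∉ J := by
      by_contra! hcon
      have := (Finset.card_eq_iff_eq_univ J).2 (Finset.eq_univ_of_forall hcon)
      omega
    have := sum_le_topWeight (d := d) (insert i J)
    rw [Finset.card_insert_of_notMem hi, Finset.sum_insert hi, hJ] at this
    have := hd i
    rw [Nat.succ_eq_add_one]
    omega

theorem topWeight_mono (hd : ∀ i, 0 < d i) : Monotone fun j : ℕ => topWeight d j := by
  refine monotone_nat_of_le_succ fun j => ?_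
  rcases le_or_gt j (Fintype.card ι) with hj | hj
  · exact_mod_cast (topWeight_lt_succ hd hj).le
  · exact (topWeight_of_card_lt hj).trans (topWeight_of_card_lt (hj.trans j.lt_succ_self)).symm |>.le

theorem sum_le_topWeight_add (J : Finset ι) {p q : ℕ} (hJ : J.card = q + (p + 1)) :
    ∑ i ∈ J, d i ≤ topWeight d ((q : ℤ) + 1) + topWeight d p := by
  classical
  obtain ⟨K, hKJ, hK⟩ := Finset.exists_subset_card_eq (s := J) (n := p) (by omega)
  have h1 := sum_le_topWeight (d := d) K
  have h2 := sum_le_topWeight (d := d) (J \ K)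
  rw [Finset.card_sdiff_of_subset hKJ, hJ, hK, show q + (p + 1) - p = q + 1 by omega,
    Nat.cast_succ] at h2
  rw [hK] at h1
  rw [← Finset.sum_sdiff hKJ]
  exact add_le_add h2 h1

variable {k : Type*} [Field k] [LinearOrder ι] {M : Type*} [AddCommGroup M]
  [Module (MvPolynomial ι k) M] {𝓜 : ℤ → AddSubgroup M}

theorem IsZeroRegular.subsingleton_of_topWeight_le (h : IsZeroRegular k d 𝓜) (hd : ∀ i, 0 < d i)
    {p q : ℕ} {e : ℤ} (he : topWeight d ((q : ℤ) + 1) ≤ e) {J : Finset ι} (hJ : J.card = q + p) :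
    Subsingleton (LocalCohomology k d 𝓜 p (e - ∑ i ∈ J, d i)) := by
  refine h p _ ?_
  rcases p with _ | p
  -- For $p=0$ regularity starts in degree $-w^{-1}=1$, so the strict inequality $w^q<w^{q+1}$ is
  -- needed.
  · have h1 := sum_le_topWeight (d := d) J
    have h2 := topWeight_lt_succ hd (J.card_le_univ)
    rw [Nat.cast_zero, zero_sub, topWeight_neg_one]
    rw [hJ, add_zero] at h1 h2
    omega
  · have h1 := sum_le_topWeight_add (d := d) J hJ
    rw [Nat.cast_succ, add_sub_cancel_right]
    omega

theorem IsZeroRegular.subsingleton_of_topWeight_card_le (h : IsZeroRegular k d 𝓜)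
    (hd : ∀ i, 0 < d i) (h0 : Subsingleton (LocalCohomology k d 𝓜 0 0))
    {p q : ℕ} {e : ℤ} (he : topWeight d (Fintype.card ι) ≤ e) {J : Finset ι}
    (hJ : J.card = q + p) : Subsingleton (LocalCohomology k d 𝓜 p (e - ∑ i ∈ J, d i)) := by
  have hJc := J.card_le_univ
  rcases p with _ | p
  · have h1 := (sum_le_topWeight (d := d) J).trans ((topWeight_mono hd hJc).trans he)
    -- With $p=0$ the degree is now only known to be nonnegative; the extra hypothesis covers degree
    -- $0$.
    rcases h1.eq_or_lt with h1 | h1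
    · rw [h1, sub_self]; exact h0
    · refine h 0 _ ?_
      rw [Nat.cast_zero, zero_sub, topWeight_neg_one]
      omega
  · refine h.subsingleton_of_topWeight_le hd (le_trans ?_ he) hJ
    exact_mod_cast topWeight_mono hd (show q + 1 ≤ Fintype.card ι by omega)

end TopWeight

end WeightedReg

/-! ### Adjoining the variables outside $I$ and conclusion -/

/-- The predicate $P$ describes a range of vanishing stable under lowering $q$ while raising $e$.
Adjoining a variable with $w_i\le0$ asks for vanishing at $(q,e-w_i)$ with $e-w_i\ge e$, which stays
in that range. -/
theorem Koszul.acyclic_union {κ R M : Type*} [LinearOrder κ] [AddCommGroup M] [CommRing R]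
    [Module R M] {w : κ → ℤ} {x : κ → R} {𝓖 : ℤ → AddSubgroup M} {I : Finset κ}
    (hx : ∀ i e, ∀ m ∈ 𝓖 e, x i • m ∈ 𝓖 (e + w i)) (hw : ∀ i ∉ I, w i ≤ 0) {P : ℕ → ℤ → Prop}
    (hP : ∀ q e e', e ≤ e' → P (q + 1) e → P q e')
    (h : ∀ q e, P q e → Koszul.Acyclic w x 𝓖 I q e) (T : Finset κ) (q : ℕ) (e : ℤ) (he : P q e) :
    Koszul.Acyclic w x 𝓖 (T ∪ I) q e := by
  induction T using Finset.induction_on generalizing q e with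
  | empty => rw [Finset.empty_union]; exact h q e he
  | insert i T _ ih =>
    rw [Finset.insert_union]
    by_cases hi : i ∈ T ∪ I
    · rw [Finset.insert_eq_of_mem hi]; exact ih q e he
    rcases q with _ | q
    · exact (ih 0 e he).insert_zero
    · have := hw i fun hI => hi (Finset.mem_union_right T hI)
      exact (ih _ e he).insert_of_acyclic hi (hx i) (ih q _ (hP q e _ (by omega) he))

namespace SimplicialFan

variable {k : Type*} [Field k] {N : Type*} [AddCommGroup N] {n : ℕ} {Δ : SimplicialFan N n}
  {M : Type*} [AddCommGroup M] [Module (MvPolynomial (Fin (n + 1)) k) M]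
  {ℳ : Δ.ClassGroup → AddSubgroup M} (hΔ : Δ.IsComplete) {I : Finset (Fin (n + 1))}

theorem mem_gradingI {a : Δ.ClassGroup} {m : M} (hm : m ∈ ℳ a) :
    m ∈ gradingI hΔ I ℳ (degI hΔ I a) :=
  le_iSup (fun a' : {a' : Δ.ClassGroup // degI hΔ I a' = degI hΔ I a} => ℳ a') ⟨a, rfl⟩ hm

theorem X_smul_mem_gradingI [SetLike.GradedSMul (Δ.coxGrading k) ℳ] (i : Fin (n + 1)) (e : ℤ)
    (m : M) (hm : m ∈ gradingI hΔ I ℳ e) :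
    (MvPolynomial.X i : MvPolynomial (Fin (n + 1)) k) • m ∈
      gradingI hΔ I ℳ (e + degI hΔ I (Δ.varDegree i)) := by
  have : gradingI hΔ I ℳ e ≤ (gradingI hΔ I ℳ (e + degI hΔ I (Δ.varDegree i))).comap
      (DistribSMul.toAddMonoidHom M (MvPolynomial.X i : MvPolynomial (Fin (n + 1)) k)) := by
    refine iSup_le ?_
    rintro ⟨a, rfl⟩ m hm
    rw [← map_add, add_comm a]
    exact mem_gradingI hΔ (SetLike.GradedSMul.smul_mem (A := Δ.coxGrading k) (B := ℳ)
      (MvPolynomial.isWeightedHomogeneous_X k Δ.varDegree i) hm)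
  exact this hm

theorem restrict_X_smul (i : I) (m : M) :
    letI := restrictModule k I M
    (MvPolynomial.X i : MvPolynomial I k) • m =
      (MvPolynomial.X (i : Fin (n + 1)) : MvPolynomial (Fin (n + 1)) k) • m := by
  change MvPolynomial.rename (R := k) (Subtype.val : I → Fin (n + 1)) (MvPolynomial.X i) • m = _
  rw [MvPolynomial.rename_X]

/-- Vanishing of local cohomology with support in `B_I` implies vanishing of the Koszul homology of
the variables `x_i`, `i ∈ I`. -/
theorem acyclic_of_localCohomologyI [SetLike.GradedSMul (Δ.coxGrading k) ℳ] (q : ℕ) (e : ℤ)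
    (h : ∀ (p : ℕ) (J : Finset I), J.card = q + p →
      Subsingleton (LocalCohomologyI k hΔ I ℳ p (e - ∑ i ∈ J, weightI hΔ I i))) :
    Koszul.Acyclic (fun i => degI hΔ I (Δ.varDegree i))
      (MvPolynomial.X : Fin (n + 1) → MvPolynomial (Fin (n + 1)) k) (gradingI hΔ I ℳ) I q e := by
  let _ : Module (MvPolynomial I k) M := restrictModule k I M
  -- The value $0$ outside $I$ is never seen: the differential only sums over $I$.
  let x : Fin (n + 1) → MvPolynomial I k := fun i => if h : i ∈ I then MvPolynomial.X ⟨i, h⟩ else 0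
  have hx : ∀ i (hi : i ∈ I), x i = MvPolynomial.X ⟨i, hi⟩ := fun i hi => dif_pos hi
  have hdiff : ∀ y : Finset (Fin (n + 1)) → M, Koszul.diff x I y =
      Koszul.diff (MvPolynomial.X : Fin (n + 1) → MvPolynomial (Fin (n + 1)) k) I y := by
    intro y
    rw [Koszul.diff_apply, Koszul.diff_apply]
    refine Finset.sum_congr rfl fun i hi => ?_
    ext J
    rw [hx i hi]
    exact restrict_X_smul ⟨i, hi⟩ _
  have key : Koszul.Acyclic (fun i => degI hΔ I (Δ.varDegree i)) x (gradingI hΔ I ℳ) I q e := by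
    refine WeightedReg.acyclic_of_localCohomology (d := weightI hΔ I) ?_ ?_ ?_ q e ?_
    · intro i e' m hm
      rw [restrict_X_smul]
      exact X_smul_mem_gradingI hΔ _ e' m hm
    · exact fun i => ⟨i, i.2, hx i i.2, rfl⟩
    · exact fun i hi => ⟨⟨i, hi⟩, hx i hi, rfl⟩
    · intro p J hJ hJc
      have h1 := h p (J.subtype (· ∈ I)) (by
        rw [Finset.card_subtype, Finset.filter_true_of_mem hJ, hJc])
      rwa [show ∑ i ∈ J.subtype (· ∈ I), weightI hΔ I i = _ from
        Finset.sum_subtype_of_mem (fun i => degI hΔ I (Δ.varDegree i)) hJ] at h1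
  intro y hy hdy
  obtain ⟨t, ht, hty⟩ := key y hy (by rw [hdiff, hdy])
  exact ⟨t, ht, by rw [← hdiff, hty]⟩

theorem not_of_gen [SetLike.GradedSMul (Δ.coxGrading k) ℳ]
    (F : MinimalFreeResolution (k := k) Δ.varDegree ℳ) {P : ℕ → ℤ → Prop}
    (hP : ∀ q e e', e ≤ e' → P (q + 1) e → P q e')
    (h : ∀ q e, P q e → ∀ (p : ℕ) (J : Finset I), J.card = q + p →
      Subsingleton (LocalCohomologyI k hΔ I ℳ p (e - ∑ i ∈ J, weightI hΔ I i)))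
    (j : ℕ) (ε : F.gen j) : ¬ P j (degI hΔ I (F.deg j ε)) := by
  intro hj
  refine F.not_koszul_exact j ε fun y hy hdy => ?_
  have := Koszul.acyclic_union (X_smul_mem_gradingI hΔ) (fun i hi => by
    rw [degI_varDegree]; exact intCoeff_nonpos hΔ hi) hP
    (fun q e he => acyclic_of_localCohomologyI hΔ q e (h q e he)) Finset.univ j _ hj
  rw [Finset.union_eq_left.2 (Finset.subset_univ I)] at this
  -- A $\operatorname{Cl}(X)$-homogeneous cycle is also $\deg_I$-homogeneous. The chain bounding it
  -- is homogeneous only for $\deg_I$, which is enough for the contradiction.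
  obtain ⟨t, -, ht⟩ := this y ⟨fun J => by
    rw [← map_sum, ← map_sub]
    exact mem_gradingI hΔ (hy.mem J), hy.supp⟩ hdy
  exact ⟨t, ht⟩

end SimplicialFan

end

theorem theorem6p9 {k : Type*} [Field k] {N : Type*} [AddCommGroup N] [Module.Free ℤ N]
    [Module.Finite ℤ N] {n : ℕ} (Δ : SimplicialFan N n) (hΔ : Δ.IsProjective)
    (I : Finset (Fin (n + 1))) (hI : Δ.IsPrimitiveCollection I)
    {M : Type*} [AddCommGroup M] [Module (MvPolynomial (Fin (n + 1)) k) M]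
    (ℳ : Δ.ClassGroup → AddSubgroup M) [DirectSum.Decomposition ℳ]
    [SetLike.GradedSMul (Δ.coxGrading k) ℳ]
    (hM : SimplicialFan.IsDegIZeroRegular k hΔ.1 I ℳ)
    (F : MinimalFreeResolution (k := k) Δ.varDegree ℳ) (j : ℕ) (ε : F.gen j) :
    SimplicialFan.degI hΔ.1 I (F.deg j ε) < SimplicialFan.wI hΔ.1 I (j + 1) ∧
      (Subsingleton (SimplicialFan.LocalCohomologyI k hΔ.1 I ℳ 0 0) →
        SimplicialFan.degI hΔ.1 I (F.deg j ε) < SimplicialFan.wI hΔ.1 I I.card) := by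
  have hd : ∀ i, 0 < SimplicialFan.weightI hΔ.1 I i := fun i => by
    rw [SimplicialFan.weightI, SimplicialFan.degI_varDegree]
    exact hI.intCoeff_pos hΔ.1 i.2
  let _ : Module (MvPolynomial I k) M := SimplicialFan.restrictModule k I M
  refine ⟨not_le.1 ?_, fun h0 => not_le.1 ?_⟩
  · refine SimplicialFan.not_of_gen hΔ.1 F
      (P := fun q e => SimplicialFan.wI hΔ.1 I ((q : ℤ) + 1) ≤ e) ?_ ?_ j ε
    · intro q e e' he h
      refine le_trans ?_ (h.trans he)
      exact_mod_cast WeightedReg.topWeight_mono hd (q + 1).le_succ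
    · exact fun q e he p J hJ =>
        WeightedReg.IsZeroRegular.subsingleton_of_topWeight_le (d := SimplicialFan.weightI hΔ.1 I)
          hM hd he hJ
  · refine SimplicialFan.not_of_gen hΔ.1 F
      (P := fun _ e => SimplicialFan.wI hΔ.1 I I.card ≤ e) (fun _ _ _ he h => h.trans he) ?_ j ε
    exact fun q e he p J hJ =>
      WeightedReg.IsZeroRegular.subsingleton_of_topWeight_card_le
        (d := SimplicialFan.weightI hΔ.1 I) hM hd h0 (by rwa [Fintype.card_coe]) hJ
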